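/- **Setting.** Let $a\in\mathbb{R}$ with $|a|\ge 2.5$, let $\sigma_0\ge 0$ and $0\le\sigma_{v1}\le\sigma_{v2}$, and let $q,r_1,r_2\ge 0$. Let $x[0]\sim\mathcal N(0,\sigma_0^2)$, $w[n]\sim\mathcal N(0,1)$, $v_1[n]\sim\mathcal N(0,\sigma_{v1}^2)$, $v_2[n]\sim\mathcal N(0,\sigma_{v2}^2)$ $(n\ge 0)$ be independent Gaussian random variables (variance $0$ means identically $0$ almost surely). Consider, for $n\ge0$, $$x[n+1]=a\,x[n]+u_1[n]+u_2[n]+w[n],\qquad y_i[n]=x[n]+v_i[n]\quad(i=1,2),$$ where the inputs are causal, $u_i[n]=f_{i,n}(y_i[0],\dots,y_i[n])$ with measurable $f_{i,n}$. Let $$J^\star=\inf_{u_1,u_2}\ \limsup_{N\to\infty}\frac1N\sum_{0\le n<N}\Big(q\,\mathbb E[x^2[n]]+r_1\mathbb E[u_1^2[n]]+r_2\mathbb E[u_2^2[n]]\Big)\in[0,\infty],$$ the infimum over all pairs of such strategies (with $0\cdot\infty=0$). **Definitions.** Write $(t)_+=\max(t,0)$, and for an integer $k_1\ge 1$ (reading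 $0/0$ as $0$, which matters only if $\sigma_{v1}=0$) $$V(k_1)=\frac{a^{2(k_1-1)}\sigma_{v1}^2}{\Big(1+\frac{\sigma_{v1}^2}{\sigma_{v2}^2}\Big)\frac{a^{2(k_1-2)}(1-a^{-2(k_1-1)})}{1-a^{-2}}+\sigma_{v1}^2}.$$ Let $S_{L,2}$ be the set of $(k_1,k,\Sigma)$ with integers $k_1\ge1$, $k\ge k_1+1$, and real $\Sigma$ with $0\le\Sigma\le 1$ if $k_1=1$ and $0\le\Sigma\le V(k_1)$ if $k_1\ge2$. Let $S_{L,3}=\{k_1\in\mathbb Z: k_1\ge 1\}$ and $S_{L,4}=\{k\in\mathbb Z:k\ge2\}$. For $P_1,P_2\ge 0$ put $$D_{L,2}(P_1,P_2;k_1,k,\Sigma)=\inf_{c_1,c_2}\ \Big(\sqrt{a^{2(k-k_1-1)}\big((a-c_1-c_2)^2\Sigma+c_1^2\sigma_{v1}^2+c_2^2\sigma_{v2}^2\big)}-\sqrt{T(P_1)}-\sqrt{T(P_2)}\Big)_+^2+1,$$ $$T(P)=\frac{a^{2(k-k_1-2)}\big(1-(2.5a^{-2})^{k-k_1-1}\big)}{1-2.5a^{-2}}\cdot\frac{P}{(1-2.5^{-1})2.5^{-1}},$$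 where the infimum is over all $c_1,c_2\in\mathbb R$ with $(1-2.5^{-1})c_i^2(\Sigma+\sigma_{vi}^2)\le P_i$ for $i=1,2$, and $$D_{L,3}(P_1,P_2;k_1)=\max\big(V(k_1),1\big),$$ $$D_{L,4}(P_1,P_2;k)=\Big(\sqrt{a^{2(k-1)}}-\sqrt{\tfrac{a^{2(k-2)}}{1-2.5a^{-2}}\tfrac{P_1}{1-2.5^{-1}}}-\sqrt{\tfrac{a^{2(k-2)}}{1-2.5a^{-2}}\tfrac{P_2}{1-2.5^{-1}}}\Big)_+^2 .$$ **Lemma.** Under these assumptions, $$J^\star\ \ge\ \sup_{(k_1,k,\Sigma)\in S_{L,2}}\ \inf_{P_1,P_2\ge0}\ q\,D_{L,2}(P_1,P_2;k_1,k,\Sigma)+r_1P_1+r_2P_2,$$ $$J^\star\ \ge\ \sup_{k_1\in S_{L,3}}\ \inf_{P_1,P_2\ge0}\ q\,D_{L,3}(P_1,P_2;k_1)+r_1P_1+r_2P_2,$$ $$J^\star\ \ge\ \sup_{k\in S_{L,4}}\ \inf_{P_1,P_2\ge0}\ q\,D_{L,4}(P_1,P_2;k)+r_1P_1+r_2P_2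 .$$ -/

import Mathlib

open MeasureTheory ProbabilityTheory Filter
open scoped ENNReal NNReal

noncomputable section

namespace DecentralizedLQG

/-- Labels of the primitive random variables: the initial state `x[0]`, the disturbances `w[n]`,
and the observation noises `v₁[n]`, `v₂[n]` of the two controllers. -/
inductive Source : Type
  | state0 : Source
  | w : ℕ → Source
  | v1 : ℕ → Source
  | v2 : ℕ → Source

/-- Variances of the primitive random variables (`σ₀`, `σ₁`, `σ₂` are standard deviations). -/
def sourceVar (σ₀ σ₁ σ₂ : ℝ≥0) : Source → ℝ≥0
  | .state0 => σ₀ ^ 2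
  | .w _ => 1
  | .v1 _ => σ₁ ^ 2
  | .v2 _ => σ₂ ^ 2

/-- `ξ` is a family of independent centred Gaussian random variables on `(Ω, μ)` with the
variances of the problem. -/
structure IsNoise {Ω : Type*} [MeasurableSpace Ω] (μ : Measure Ω) (σ₀ σ₁ σ₂ : ℝ≥0)
    (ξ : Source → Ω → ℝ) : Prop where
  measurable : ∀ s, Measurable (ξ s)
  law : ∀ s, μ.map (ξ s) = gaussianReal 0 (sourceVar σ₀ σ₁ σ₂ s)
  indep : iIndepFun ξ μ

/-- A measurable causal strategy of one controller: at time `n` it applies a measurable function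
to its own observations at the times `0, …, n`. -/
structure Strategy where
  map : (n : ℕ) → (Fin (n + 1) → ℝ) → ℝ
  measurable_map : ∀ n, Measurable (map n)

/-- The state `x[n]` for the strategies `f₁`, `f₂` and the realization `e` of the primitive random
variables: `x[n+1] = a x[n] + u₁[n] + u₂[n] + w[n]`, where
`uᵢ[n] = fᵢ,ₙ (yᵢ[0], …, yᵢ[n])` and `yᵢ[m] = x[m] + vᵢ[m]`. -/
def state (a : ℝ) (f₁ f₂ : Strategy) (e : Source → ℝ) : ℕ → ℝ
  | 0 => e .state0
  | n + 1 => a * state a f₁ f₂ e n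
      + f₁.map n (fun m : Fin (n + 1) => state a f₁ f₂ e m + e (.v1 m))
      + f₂.map n (fun m : Fin (n + 1) => state a f₁ f₂ e m + e (.v2 m))
      + e (.w n)

/-- The input `u₁[n]` of the first controller. -/
def input1 (a : ℝ) (f₁ f₂ : Strategy) (e : Source → ℝ) (n : ℕ) : ℝ :=
  f₁.map n (fun m : Fin (n + 1) => state a f₁ f₂ e m + e (.v1 m))

/-- The input `u₂[n]` of the second controller. -/
def input2 (a : ℝ) (f₁ f₂ : Strategy) (e : Source → ℝ) (n : ℕ) : ℝ :=
  f₂.map n (fun m : Fin (n + 1) => state a f₁ f₂ e m + e (.v2 m))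

variable {Ω : Type*} [MeasurableSpace Ω]

/-- The second moment `E[X²]`, a value in `[0, ∞]`. -/
def secondMoment (μ : Measure Ω) (X : Ω → ℝ) : ℝ≥0∞ :=
  ∫⁻ ω, ENNReal.ofReal (X ω ^ 2) ∂μ

/-- The long-term average cost
`limsup_N (1/N) ∑_{n < N} (q E[x[n]²] + r₁ E[u₁[n]²] + r₂ E[u₂[n]²])` of two strategies. -/
def averageCost (μ : Measure Ω) (ξ : Source → Ω → ℝ) (a : ℝ) (q r₁ r₂ : ℝ≥0)
    (f₁ f₂ : Strategy) : ℝ≥0∞ :=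
  limsup (fun N : ℕ =>
    (∑ n ∈ Finset.range N,
      ((q : ℝ≥0∞) * secondMoment μ (fun ω => state a f₁ f₂ (fun s => ξ s ω) n)
        + (r₁ : ℝ≥0∞) * secondMoment μ (fun ω => input1 a f₁ f₂ (fun s => ξ s ω) n)
        + (r₂ : ℝ≥0∞) * secondMoment μ (fun ω => input2 a f₁ f₂ (fun s => ξ s ω) n)))
      / (N : ℝ≥0∞)) atTop

/-- The optimal cost: the infimum over all pairs of measurable causal strategies. -/
def optimalCost (μ : Measure Ω) (ξ : Source → Ω → ℝ) (a : ℝ) (q r₁ r₂ : ℝ≥0) : ℝ≥0∞ :=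
  ⨅ (f₁ : Strategy) (f₂ : Strategy), averageCost μ ξ a q r₁ r₂ f₁ f₂

/-- The quantity
`a^{2(k₁-1)} σ₁² / ((1 + σ₁²/σ₂²) (a^{2(k₁-2)} (1 - a^{-2(k₁-1)}) / (1 - a^{-2})) + σ₁²)`. -/
def infoVar (a σ₁ σ₂ : ℝ) (k₁ : ℕ) : ℝ :=
  a ^ (2 * ((k₁ : ℤ) - 1)) * σ₁ ^ 2 /
    ((1 + σ₁ ^ 2 / σ₂ ^ 2) *
        (a ^ (2 * ((k₁ : ℤ) - 2)) * (1 - a ^ (-2 * ((k₁ : ℤ) - 1))) / (1 - a ^ (-2 : ℤ)))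
      + σ₁ ^ 2)

/-- The parameter set `S_{L,2}` of triples `(k₁, k, Σ)`. -/
def SL2 (a σ₁ σ₂ : ℝ) : Set (ℕ × ℕ × ℝ) :=
  {p | 1 ≤ p.1 ∧ p.1 + 1 ≤ p.2.1 ∧ 0 ≤ p.2.2 ∧
    p.2.2 ≤ if p.1 = 1 then 1 else infoVar a σ₁ σ₂ p.1}

/-- The parameter set `S_{L,3}`. -/
def SL3 : Set ℕ := {k₁ | 1 ≤ k₁}

/-- The parameter set `S_{L,4}`. -/
def SL4 : Set ℕ := {k | 2 ≤ k}

/-- The square of the root of the power bound in `DL2`: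
`a^{2(k-k₁-2)} (1 - (2.5 a^{-2})^{k-k₁-1}) / (1 - 2.5 a^{-2}) · P / ((1 - 2.5⁻¹) 2.5⁻¹)`.
The integer exponents are used for `k ≥ k₁ + 1`. -/
def powerTerm (a : ℝ) (k₁ k : ℕ) (P : ℝ) : ℝ :=
  a ^ (2 * ((k : ℤ) - k₁ - 2)) * (1 - (2.5 * a ^ (-2 : ℤ)) ^ ((k : ℤ) - k₁ - 1)) /
      (1 - 2.5 * a ^ (-2 : ℤ))
    * (P / ((1 - 2.5⁻¹) * 2.5⁻¹))

/-- The bound `D_{L,2}(P₁, P₂; k₁, k, Σ)` with `S` for `Σ`: an infimum over the linear gains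
`c₁, c₂` that satisfy the two power constraints. For `P₁, P₂ ≥ 0` the set is nonempty
(it contains the value at `c₁ = c₂ = 0`), and it is bounded below by `1`. -/
def DL2 (a σ₁ σ₂ P₁ P₂ : ℝ) (k₁ k : ℕ) (S : ℝ) : ℝ :=
  sInf {d : ℝ | ∃ c₁ c₂ : ℝ,
    (1 - 2.5⁻¹) * c₁ ^ 2 * (S + σ₁ ^ 2) ≤ P₁ ∧
    (1 - 2.5⁻¹) * c₂ ^ 2 * (S + σ₂ ^ 2) ≤ P₂ ∧
    d = (max 0
        (√(a ^ (2 * ((k : ℤ) - k₁ - 1)) *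
            ((a - c₁ - c₂) ^ 2 * S + c₁ ^ 2 * σ₁ ^ 2 + c₂ ^ 2 * σ₂ ^ 2))
          - √(powerTerm a k₁ k P₁) - √(powerTerm a k₁ k P₂))) ^ 2 + 1}

/-- The bound `D_{L,3}(P₁, P₂; k₁)`; it does not depend on `P₁, P₂`. -/
def DL3 (a σ₁ σ₂ : ℝ) (_P₁ _P₂ : ℝ) (k₁ : ℕ) : ℝ :=
  max (infoVar a σ₁ σ₂ k₁) 1

/-- The bound `D_{L,4}(P₁, P₂; k)`. -/
def DL4 (a P₁ P₂ : ℝ) (k : ℕ) : ℝ :=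
  (max 0
    (√(a ^ (2 * ((k : ℤ) - 1)))
      - √(a ^ (2 * ((k : ℤ) - 2)) / (1 - 2.5 * a ^ (-2 : ℤ)) * (P₁ / (1 - 2.5⁻¹)))
      - √(a ^ (2 * ((k : ℤ) - 2)) / (1 - 2.5 * a ^ (-2 : ℤ)) * (P₂ / (1 - 2.5⁻¹))))) ^ 2

/-- The minimization `inf_{P₁, P₂ ≥ 0} q D(P₁, P₂) + r₁ P₁ + r₂ P₂` for a nonnegative `D`. -/
def weightedInf (q r₁ r₂ : ℝ≥0) (D : ℝ → ℝ → ℝ) : ℝ≥0∞ :=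
  ⨅ (P₁ : ℝ≥0) (P₂ : ℝ≥0), ENNReal.ofReal (q * D P₁ P₂ + r₁ * P₁ + r₂ * P₂)

end DecentralizedLQG

end

/-!
The cost is averaged over windows `n, …, n + k`, and each window is bounded below by following the
fresh disturbance `w[n]` through it. Every term of the cost sequence is hit by the windows with
total weight at most one (the geometric weights `weight j` have mass one), so a bound `B` valid
for each window is a bound for the average cost (`weightedInf_le_averageCost`).

Inside a window, give both controllers everything except `w[n]`, which they see only through the
noisy observations after time `n`. The Kalman filter then splits the state into a Gaussian
estimation error `X`, independent of the shared information `F`, and an `F`-measurable rest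
(`IsInnovation`). The variance of `X` obeys the Riccati recursion solved by `infoVar`
(`exists_isInnovation`), and it is a lower bound for `E[x²]`, which gives the bound `DL3`.

For `DL2`, the decentralized inputs `uᵢ[m]`, `m = n + k₁`, depend on `F` and on `X + vᵢ[m]` alone.
A Gaussian variable orthogonal to `X + vᵢ[m]` in the span of `X`, `v₁[m]`, `v₂[m]` is independent
of `uᵢ[m]`, so the projection of `uᵢ[m]` onto this span is a multiple `-cᵢ (X + vᵢ[m])` of the
observation. Hence `a x[m] + u₁[m] + u₂[m]` has at least the second moment that the linear inputs
with gains `cᵢ` produce, and these need no more power (`exists_linear_gains`). The later inputs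
change the state at the end of the window by an amount that Minkowski's inequality and a weighted
Cauchy–Schwarz inequality bound by the powers (`sqrt_integral_passive_le`,
`integral_drive_sq_le`). The last disturbance adds the constant `1`. `DL4` is the same propagation
argument started from `w[n]` itself.

The case `q = 0` is trivial. For `q > 0` an input may fail to be square integrable while the cost
is finite, but only if `r₁ = r₂ = 0`, since the sum of the two inputs is square integrable. Then the infimum over `P₁, P₂` is free, and
it is compared with the centralized bound (`exists_DL2_le_integral`, `exists_DL4_eq_zero`).
-/

noncomputable section

namespace DecentralizedLQG

/-! ### Independence and second moments -/

section SecondMoments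

variable {Ω : Type*} {mΩ : MeasurableSpace Ω} {μ : Measure Ω}

/-- The contraction rule for independence: if `m₁` is independent of `m₂`, and both together of
`m₃`, then `m₁` is independent of `m₂` and `m₃` together. -/
lemma indep_sup_of_indep_sup [IsProbabilityMeasure μ] {m₁ m₂ m₃ : MeasurableSpace Ω}
    (h₁ : m₁ ≤ mΩ) (h₂ : m₂ ≤ mΩ) (h₃ : m₃ ≤ mΩ)
    (h₁₂ : Indep m₁ m₂ μ) (h : Indep (m₁ ⊔ m₂) m₃ μ) : Indep m₁ (m₂ ⊔ m₃) μ := by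
  have hgen : m₂ ⊔ m₃ = MeasurableSpace.generateFrom
      {s | ∃ A B, MeasurableSet[m₂] A ∧ MeasurableSet[m₃] B ∧ A ∩ B = s} := by
    apply le_antisymm
    · refine sup_le (fun A hA => ?_) (fun B hB => ?_)
      · exact MeasurableSpace.measurableSet_generateFrom
          ⟨A, Set.univ, hA, MeasurableSet.univ, Set.inter_univ A⟩
      · exact MeasurableSpace.measurableSet_generateFrom
          ⟨Set.univ, B, MeasurableSet.univ, hB, Set.univ_inter B⟩
    · refine MeasurableSpace.generateFrom_le ?_
      rintro _ ⟨A, B, hA, hB, rfl⟩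
      exact MeasurableSet.inter (le_sup_left (a := m₂) (b := m₃) A hA)
        (le_sup_right (a := m₂) (b := m₃) B hB)
  refine IndepSets.indep (p1 := {s | MeasurableSet[m₁] s})
    (p2 := {s | ∃ A B, MeasurableSet[m₂] A ∧ MeasurableSet[m₃] B ∧ A ∩ B = s})
    h₁ (sup_le h₂ h₃) (@MeasurableSpace.isPiSystem_measurableSet Ω m₁) ?_
    (@MeasurableSpace.generateFrom_measurableSet Ω m₁).symm hgen ?_
  · rintro _ ⟨A, B, hA, hB, rfl⟩ _ ⟨A', B', hA', hB', rfl⟩ _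
    exact ⟨A ∩ A', B ∩ B', hA.inter hA', hB.inter hB', Set.inter_inter_inter_comm A A' B B'⟩
  · rw [IndepSets_iff]
    rintro S _ hS ⟨A, B, hA, hB, rfl⟩
    rw [Indep_iff] at h h₁₂
    have hSA : MeasurableSet[m₁ ⊔ m₂] (S ∩ A) :=
      MeasurableSet.inter (le_sup_left (a := m₁) (b := m₂) S hS)
        (le_sup_right (a := m₁) (b := m₂) A hA)
    rw [← Set.inter_assoc, h _ _ hSA hB, h₁₂ _ _ hS hA,
      h _ _ (le_sup_right (a := m₁) (b := m₂) A hA) hB, mul_assoc]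

/-- Uncorrelated jointly Gaussian variables are independent, for a variable and a pair. -/
lemma indep_comap_sup_of_cov_eq_zero {E Y₁ Y₂ : Ω → ℝ}
    (hG : HasGaussianLaw (fun ω => (E ω, (Y₁ ω, Y₂ ω))) μ)
    (h₁ : cov[E, Y₁; μ] = 0) (h₂ : cov[E, Y₂; μ] = 0) :
    Indep (MeasurableSpace.comap E inferInstance)
      (MeasurableSpace.comap Y₁ inferInstance ⊔ MeasurableSpace.comap Y₂ inferInstance) μ := by
  have hp := hG.isProbabilityMeasure
  have hY := hG.snd
  have key : IndepFun E (fun ω => (Y₁ ω, Y₂ ω)) μ := by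
    refine hG.indepFun_of_covariance_strongDual fun L₁ L₂ => ?_
    have e₁ : L₁ ∘ E = fun ω => L₁ 1 * E ω := by
      funext ω
      have : E ω = E ω • (1 : ℝ) := by simp
      rw [Function.comp_apply, this, map_smul]; simp [mul_comm]
    have e₂ : L₂ ∘ (fun ω => (Y₁ ω, Y₂ ω))
        = (fun ω => L₂ (1, 0) * Y₁ ω) + fun ω => L₂ (0, 1) * Y₂ ω := by
      funext ω
      have : (Y₁ ω, Y₂ ω) = Y₁ ω • ((1 : ℝ), (0 : ℝ)) + Y₂ ω • ((0 : ℝ), (1 : ℝ)) := by simp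
      rw [Function.comp_apply, this, map_add, map_smul, map_smul]; simp [mul_comm]
    rw [e₁, e₂, covariance_add_right, covariance_const_mul_left, covariance_const_mul_left,
      covariance_const_mul_right, covariance_const_mul_right, h₁, h₂]
    · simp
    · exact hG.fst.memLp_two.const_mul _
    · exact hY.fst.memLp_two.const_mul _
    · exact hY.snd.memLp_two.const_mul _
  have := (IndepFun_iff_Indep _ _ _).1 key
  have e : MeasurableSpace.comap (fun ω => (Y₁ ω, Y₂ ω)) inferInstance
      = MeasurableSpace.comap Y₁ inferInstance ⊔ MeasurableSpace.comap Y₂ inferInstance :=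
    MeasurableSpace.comap_prodMk Y₁ Y₂
  rwa [← e]

lemma integral_mul_eq_zero_of_indep {X Y : Ω → ℝ} {F : MeasurableSpace Ω}
    (hF : F ≤ mΩ) (hX : Measurable[mΩ] X) (hi : Indep (MeasurableSpace.comap X inferInstance) F μ)
    (hX0 : ∫ ω, X ω ∂μ = 0) (hY : Measurable[F] Y) : ∫ ω, X ω * Y ω ∂μ = 0 := by
  have h : IndepFun X Y μ := by
    rw [IndepFun_iff_Indep]
    exact indep_of_indep_of_le_right hi hY.comap_le
  rw [h.integral_fun_mul_eq_mul_integral hX.aestronglyMeasurable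
    (hY.mono hF le_rfl).aestronglyMeasurable, hX0, zero_mul]

lemma integral_add_sq {X Y : Ω → ℝ} (hX : MemLp X 2 μ) (hY : MemLp Y 2 μ) :
    ∫ ω, (X ω + Y ω) ^ 2 ∂μ
      = ∫ ω, X ω ^ 2 ∂μ + 2 * ∫ ω, X ω * Y ω ∂μ + ∫ ω, Y ω ^ 2 ∂μ := by
  have hxy : Integrable (fun ω => X ω * Y ω) μ := hX.integrable_mul hY
  have : ∀ ω, (X ω + Y ω) ^ 2 = X ω ^ 2 + 2 * (X ω * Y ω) + Y ω ^ 2 := fun ω => by ring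
  simp_rw [this]
  rw [integral_add (f := fun ω => X ω ^ 2 + 2 * (X ω * Y ω)) (g := fun ω => Y ω ^ 2)
      (hX.integrable_sq.add (hxy.const_mul 2)) hY.integrable_sq,
    integral_add (f := fun ω => X ω ^ 2) hX.integrable_sq (hxy.const_mul 2), integral_const_mul]

lemma integral_add_sq_of_indep {X Y : Ω → ℝ} {F : MeasurableSpace Ω} (hF : F ≤ mΩ)
    (hXm : Measurable[mΩ] X) (hX : MemLp X 2 μ) (hY : MemLp Y 2 μ)
    (hi : Indep (MeasurableSpace.comap X inferInstance) F μ)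
    (hX0 : ∫ ω, X ω ∂μ = 0) (hYF : Measurable[F] Y) :
    ∫ ω, (X ω + Y ω) ^ 2 ∂μ = ∫ ω, X ω ^ 2 ∂μ + ∫ ω, Y ω ^ 2 ∂μ := by
  rw [integral_add_sq hX hY, integral_mul_eq_zero_of_indep hF hXm hi hX0 hYF]
  ring

lemma sqrt_integral_sq_eq_eLpNorm {X : Ω → ℝ} (hX : MemLp X 2 μ) :
    √(∫ ω, X ω ^ 2 ∂μ) = (eLpNorm X 2 μ).toReal := by
  rw [hX.eLpNorm_eq_integral_rpow_norm (by norm_num) (by norm_num),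
    ENNReal.toReal_ofReal (by positivity), Real.sqrt_eq_rpow]
  simp

/-- Minkowski's inequality for root mean squares. -/
lemma sqrt_integral_add_sq_le {X Y : Ω → ℝ} (hX : MemLp X 2 μ) (hY : MemLp Y 2 μ) :
    √(∫ ω, (X ω + Y ω) ^ 2 ∂μ) ≤ √(∫ ω, X ω ^ 2 ∂μ) + √(∫ ω, Y ω ^ 2 ∂μ) := by
  have := sqrt_integral_sq_eq_eLpNorm (hX.add hY)
  simp only [Pi.add_apply] at this
  rw [this, sqrt_integral_sq_eq_eLpNorm hX, sqrt_integral_sq_eq_eLpNorm hY,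
    ← ENNReal.toReal_add hX.2.ne hY.2.ne]
  exact ENNReal.toReal_mono (ENNReal.add_ne_top.2 ⟨hX.2.ne, hY.2.ne⟩)
    (eLpNorm_add_le hX.1 hY.1 (by norm_num))

lemma secondMoment_eq_ofReal {X : Ω → ℝ} (hX : MemLp X 2 μ) :
    secondMoment μ X = ENNReal.ofReal (∫ ω, X ω ^ 2 ∂μ) := by
  rw [secondMoment, ofReal_integral_eq_lintegral_ofReal hX.integrable_sq
    (ae_of_all _ fun ω => sq_nonneg _)]

lemma memLp_of_secondMoment_ne_top {X : Ω → ℝ} (hX : Measurable X)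
    (h : secondMoment μ X ≠ ∞) : MemLp X 2 μ := by
  rw [memLp_two_iff_integrable_sq hX.aestronglyMeasurable]
  refine ⟨(hX.pow_const 2).aestronglyMeasurable, ?_⟩
  rw [hasFiniteIntegral_iff_ofReal (ae_of_all _ fun ω => sq_nonneg _)]
  exact lt_top_iff_ne_top.2 h

end SecondMoments

/-! ### Averages over windows -/

section Averaging

/-- The shift by `k` in the number of summands does not matter for the limit of the averages. -/
lemma le_limsup_average {B : ℝ≥0∞} (hB : B ≠ ∞) (c : ℕ → ℝ≥0∞) (k : ℕ)
    (h : ∀ N : ℕ, N * B ≤ ∑ m ∈ Finset.range (N + k), c m) :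
    B ≤ limsup (fun N : ℕ => (∑ m ∈ Finset.range N, c m) / (N : ℝ≥0∞)) atTop := by
  obtain ⟨b, rfl⟩ : ∃ b : ℝ≥0, B = b := ⟨B.toNNReal, (ENNReal.coe_toNNReal hB).symm⟩
  have ht : Tendsto (fun N : ℕ => ENNReal.ofReal ((b : ℝ) - k * b / N)) atTop
      (nhds (b : ℝ≥0∞)) := by
    have h1 : Tendsto (fun N : ℕ => (b : ℝ) - k * b / N) atTop (nhds ((b : ℝ) - 0)) :=
      tendsto_const_nhds.sub (tendsto_const_div_atTop_nhds_zero_nat _)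
    have h2 := ENNReal.tendsto_ofReal h1
    simpa using h2
  rw [← ht.limsup_eq]
  refine limsup_le_limsup ?_
  filter_upwards [eventually_ge_atTop (k + 1)] with N hN
  obtain ⟨M, rfl⟩ : ∃ M, N = M + k := ⟨N - k, by omega⟩
  have hpos : (0 : ℝ) < ((M + k : ℕ) : ℝ) := by exact_mod_cast (by omega : 0 < M + k)
  rw [ENNReal.le_div_iff_mul_le (Or.inl (by simp; omega)) (Or.inl (by simp))]
  refine le_trans (le_of_eq ?_) (h M)
  rw [← ENNReal.ofReal_natCast (M + k), ← ENNReal.ofReal_mul' hpos.le, ← ENNReal.ofReal_coe_nnreal,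
    ← ENNReal.ofReal_natCast M, ← ENNReal.ofReal_mul (by positivity)]
  congr 1
  field_simp
  push_cast
  ring

/-- The geometric weights `(1 - 2.5⁻¹) 2.5⁻ʲ`, whose total mass is `1`. -/
def weight (j : ℕ) : ℝ := (1 - 2.5⁻¹) * 2.5⁻¹ ^ j

lemma weight_pos (j : ℕ) : 0 < weight j := mul_pos (by norm_num) (by positivity)

lemma sum_weight_le_one (L : ℕ) : ∑ j ∈ Finset.range L, weight j ≤ 1 := by
  have h : ∑ j ∈ Finset.range L, weight j = 1 - 2.5⁻¹ ^ L := by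
    induction L with
    | zero => simp
    | succ L ih => rw [Finset.sum_range_succ, ih, weight, pow_succ]; ring
  rw [h]
  have : (0 : ℝ) ≤ 2.5⁻¹ ^ L := by positivity
  linarith

/-- The geometrically weighted sum of `c` over the window `s, …, s + L - 1`. -/
def windowPower (c : ℕ → ℝ≥0∞) (s L : ℕ) : ℝ≥0∞ :=
  ∑ j ∈ Finset.range L, ENNReal.ofReal (weight j) * c (s + j)

lemma sum_shift_le (c : ℕ → ℝ≥0∞) {s k N : ℕ} (hs : s ≤ k) :
    ∑ n ∈ Finset.range N, c (n + s) ≤ ∑ m ∈ Finset.range (N + k), c m := by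
  rw [← Finset.sum_image (g := fun n => n + s) (f := c) (by intro x _ y _ h; simpa using h)]
  refine Finset.sum_le_sum_of_subset fun m hm => ?_
  obtain ⟨n, hn, rfl⟩ := Finset.mem_image.1 hm
  have := Finset.mem_range.1 hn
  exact Finset.mem_range.2 (by omega)

/-- Since the weights have total mass at most one, the windows that start at successive times
count each term at most once. -/
lemma sum_windowPower_le (c : ℕ → ℝ≥0∞) {s L k : ℕ} (hk : s + L ≤ k) (N : ℕ) :
    ∑ n ∈ Finset.range N, windowPower c (n + s) L ≤ ∑ m ∈ Finset.range (N + k), c m := by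
  unfold windowPower
  rw [Finset.sum_comm]
  calc ∑ j ∈ Finset.range L, ∑ n ∈ Finset.range N, ENNReal.ofReal (weight j) * c (n + s + j)
      ≤ ∑ j ∈ Finset.range L, ENNReal.ofReal (weight j) * ∑ m ∈ Finset.range (N + k), c m := by
        refine Finset.sum_le_sum fun j hj => ?_
        rw [← Finset.mul_sum]
        gcongr
        simp_rw [add_assoc]
        exact sum_shift_le c (by have := Finset.mem_range.1 hj; omega)
    _ = ENNReal.ofReal (∑ j ∈ Finset.range L, weight j) * ∑ m ∈ Finset.range (N + k), c m := by
        rw [← Finset.sum_mul, ENNReal.ofReal_sum_of_nonneg fun j _ => (weight_pos j).le]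
    _ ≤ 1 * ∑ m ∈ Finset.range (N + k), c m := by
        gcongr
        exact ENNReal.ofReal_le_one.2 (sum_weight_le_one L)
    _ = _ := one_mul _

end Averaging

/-! ### Gaussian triples -/

section Triple

variable {Ω : Type*} {mΩ : MeasurableSpace Ω} {μ : Measure Ω}

/-- A jointly Gaussian triple of centred, mutually uncorrelated variables with variances
`V`, `s`, `t`. -/
structure IsGaussianTriple (μ : Measure Ω) (X A B : Ω → ℝ) (V s t : ℝ) : Prop where
  joint : HasGaussianLaw (fun ω => (X ω, (A ω, B ω))) μ
  mean₀ : ∫ ω, X ω ∂μ = 0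
  mean₁ : ∫ ω, A ω ∂μ = 0
  mean₂ : ∫ ω, B ω ∂μ = 0
  var₀ : ∫ ω, X ω * X ω ∂μ = V
  var₁ : ∫ ω, A ω * A ω ∂μ = s
  var₂ : ∫ ω, B ω * B ω ∂μ = t
  cross₀₁ : ∫ ω, X ω * A ω ∂μ = 0
  cross₀₂ : ∫ ω, X ω * B ω ∂μ = 0
  cross₁₂ : ∫ ω, A ω * B ω ∂μ = 0

/-- The linear combination `c₀ X + c₁ A + c₂ B`. -/
def comb (X A B : Ω → ℝ) (c₀ c₁ c₂ : ℝ) (ω : Ω) : ℝ := c₀ * X ω + c₁ * A ω + c₂ * B ω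

namespace IsGaussianTriple

variable {X A B : Ω → ℝ} {V s t : ℝ}

lemma memLp₀ (h : IsGaussianTriple μ X A B V s t) : MemLp X 2 μ := h.joint.fst.memLp_two
lemma memLp₁ (h : IsGaussianTriple μ X A B V s t) : MemLp A 2 μ := h.joint.snd.fst.memLp_two
lemma memLp₂ (h : IsGaussianTriple μ X A B V s t) : MemLp B 2 μ := h.joint.snd.snd.memLp_two

lemma memLp_comb (h : IsGaussianTriple μ X A B V s t) (c₀ c₁ c₂ : ℝ) :
    MemLp (comb X A B c₀ c₁ c₂) 2 μ :=
  ((h.memLp₀.const_mul c₀).add (h.memLp₁.const_mul c₁)).add (h.memLp₂.const_mul c₂)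

lemma integral_comb (h : IsGaussianTriple μ X A B V s t) (c₀ c₁ c₂ : ℝ) :
    ∫ ω, comb X A B c₀ c₁ c₂ ω ∂μ = 0 := by
  have hp := h.joint.isProbabilityMeasure
  have i₀ := (h.memLp₀.integrable (by norm_num)).const_mul c₀
  have i₁ := (h.memLp₁.integrable (by norm_num)).const_mul c₁
  have i₂ := (h.memLp₂.integrable (by norm_num)).const_mul c₂
  unfold comb
  rw [integral_add (f := fun ω => c₀ * X ω + c₁ * A ω) (i₀.add i₁) i₂, integral_add i₀ i₁,
    integral_const_mul, integral_const_mul, integral_const_mul, h.mean₀, h.mean₁, h.mean₂]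
  simp

lemma integral_comb_mul {Z : Ω → ℝ} (hZ : MemLp Z 2 μ)
    (h : IsGaussianTriple μ X A B V s t) (c₀ c₁ c₂ : ℝ) :
    ∫ ω, comb X A B c₀ c₁ c₂ ω * Z ω ∂μ
      = c₀ * ∫ ω, X ω * Z ω ∂μ + c₁ * ∫ ω, A ω * Z ω ∂μ + c₂ * ∫ ω, B ω * Z ω ∂μ := by
  have i₀ : Integrable (fun ω => c₀ * (X ω * Z ω)) μ := (h.memLp₀.integrable_mul hZ).const_mul c₀
  have i₁ : Integrable (fun ω => c₁ * (A ω * Z ω)) μ := (h.memLp₁.integrable_mul hZ).const_mul c₁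
  have i₂ : Integrable (fun ω => c₂ * (B ω * Z ω)) μ := (h.memLp₂.integrable_mul hZ).const_mul c₂
  have e : ∀ ω, comb X A B c₀ c₁ c₂ ω * Z ω
      = c₀ * (X ω * Z ω) + c₁ * (A ω * Z ω) + c₂ * (B ω * Z ω) := fun ω => by
    unfold comb; ring
  simp_rw [e]
  rw [integral_add (f := fun ω => c₀ * (X ω * Z ω) + c₁ * (A ω * Z ω)) (i₀.add i₁) i₂,
    integral_add i₀ i₁, integral_const_mul, integral_const_mul, integral_const_mul]

lemma integral_comb_mul_comb (h : IsGaussianTriple μ X A B V s t) (c₀ c₁ c₂ d₀ d₁ d₂ : ℝ) :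
    ∫ ω, comb X A B c₀ c₁ c₂ ω * comb X A B d₀ d₁ d₂ ω ∂μ
      = c₀ * d₀ * V + c₁ * d₁ * s + c₂ * d₂ * t := by
  have e (Z : Ω → ℝ) (hZ : MemLp Z 2 μ) : ∫ ω, Z ω * comb X A B d₀ d₁ d₂ ω ∂μ
      = d₀ * ∫ ω, X ω * Z ω ∂μ + d₁ * ∫ ω, A ω * Z ω ∂μ + d₂ * ∫ ω, B ω * Z ω ∂μ := by
    rw [← h.integral_comb_mul hZ]
    simp_rw [mul_comm]
  have c₁₀ : ∫ ω, A ω * X ω ∂μ = 0 := by simp_rw [mul_comm (A _), h.cross₀₁]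
  have c₂₀ : ∫ ω, B ω * X ω ∂μ = 0 := by simp_rw [mul_comm (B _), h.cross₀₂]
  have c₂₁ : ∫ ω, B ω * A ω ∂μ = 0 := by simp_rw [mul_comm (B _), h.cross₁₂]
  rw [h.integral_comb_mul (h.memLp_comb _ _ _), e X h.memLp₀, e A h.memLp₁, e B h.memLp₂,
    h.var₀, h.var₁, h.var₂, h.cross₀₁, h.cross₀₂, h.cross₁₂, c₁₀, c₂₀, c₂₁]
  ring

lemma integral_comb_sq (h : IsGaussianTriple μ X A B V s t) (c₀ c₁ c₂ : ℝ) :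
    ∫ ω, comb X A B c₀ c₁ c₂ ω ^ 2 ∂μ = c₀ ^ 2 * V + c₁ ^ 2 * s + c₂ ^ 2 * t := by
  simp_rw [pow_two]
  exact h.integral_comb_mul_comb _ _ _ _ _ _

lemma covariance_comb (h : IsGaussianTriple μ X A B V s t) (c₀ c₁ c₂ d₀ d₁ d₂ : ℝ) :
    cov[comb X A B c₀ c₁ c₂, comb X A B d₀ d₁ d₂; μ]
      = c₀ * d₀ * V + c₁ * d₁ * s + c₂ * d₂ * t := by
  have hp := h.joint.isProbabilityMeasure
  rw [covariance_eq_sub (h.memLp_comb _ _ _) (h.memLp_comb _ _ _)]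
  simp only [Pi.mul_apply]
  rw [h.integral_comb_mul_comb, h.integral_comb, zero_mul, sub_zero]

lemma hasGaussianLaw_comb (h : IsGaussianTriple μ X A B V s t) (c₀ c₁ c₂ : ℝ) :
    HasGaussianLaw (comb X A B c₀ c₁ c₂) μ := by
  let fst := ContinuousLinearMap.fst ℝ ℝ (ℝ × ℝ)
  let snd := ContinuousLinearMap.snd ℝ ℝ (ℝ × ℝ)
  have := h.joint.map_fun (c₀ • fst + c₁ • (ContinuousLinearMap.fst ℝ ℝ ℝ ∘L snd)
    + c₂ • (ContinuousLinearMap.snd ℝ ℝ ℝ ∘L snd))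
  have e : comb X A B c₀ c₁ c₂ = fun ω => c₀ * X ω + c₁ * A ω + c₂ * B ω := rfl
  rw [e]
  simpa [fst, snd, smul_eq_mul] using this

/-- A combination uncorrelated with two others is independent of them jointly. -/
lemma indep_comb (h : IsGaussianTriple μ X A B V s t) {e₀ e₁ e₂ c₀ c₁ c₂ d₀ d₁ d₂ : ℝ}
    (hc : e₀ * c₀ * V + e₁ * c₁ * s + e₂ * c₂ * t = 0)
    (hd : e₀ * d₀ * V + e₁ * d₁ * s + e₂ * d₂ * t = 0) :
    Indep (MeasurableSpace.comap (comb X A B e₀ e₁ e₂) inferInstance)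
      (MeasurableSpace.comap (comb X A B c₀ c₁ c₂) inferInstance
        ⊔ MeasurableSpace.comap (comb X A B d₀ d₁ d₂) inferInstance) μ := by
  refine indep_comap_sup_of_cov_eq_zero ?_ ?_ ?_
  · let fst := ContinuousLinearMap.fst ℝ ℝ (ℝ × ℝ)
    let snd₁ := ContinuousLinearMap.fst ℝ ℝ ℝ ∘L ContinuousLinearMap.snd ℝ ℝ (ℝ × ℝ)
    let snd₂ := ContinuousLinearMap.snd ℝ ℝ ℝ ∘L ContinuousLinearMap.snd ℝ ℝ (ℝ × ℝ)
    have := h.joint.map_fun ((e₀ • fst + e₁ • snd₁ + e₂ • snd₂).prod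
      ((c₀ • fst + c₁ • snd₁ + c₂ • snd₂).prod (d₀ • fst + d₁ • snd₁ + d₂ • snd₂)))
    simpa [fst, snd₁, snd₂, comb, smul_eq_mul] using this
  · rw [h.covariance_comb, hc]
  · rw [h.covariance_comb, hd]

end IsGaussianTriple

end Triple

/-! ### The primitive random variables -/

section Sources

/-- The first time at which a primitive variable can influence the state. -/
def Source.onset : Source → ℕ
  | .state0 => 0
  | .w n => n + 1
  | .v1 n => n + 1
  | .v2 n => n + 1

/-- The primitive variables that determine the state at time `n` and the earlier observations. -/
def past (n : ℕ) : Set Source := {s | s.onset ≤ n}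

/-- The primitive variables that determine the state, the observations and the inputs at
time `n`. -/
def present (n : ℕ) : Set Source := past (n + 1) \ {.w n}

lemma past_mono : Monotone past := fun _ _ h _ hs => le_trans hs h

lemma past_subset_present (n : ℕ) : past n ⊆ present n := fun s hs =>
  ⟨past_mono n.le_succ hs, by rintro rfl; simp [past, Source.onset] at hs⟩

lemma present_subset_past (n : ℕ) : present n ⊆ past (n + 1) := Set.sdiff_subset

variable {Ω : Type*}

/-- The `σ`-algebra generated by the primitive variables with labels in `T`. -/
@[reducible]
def sourceAlg (ξ : Source → Ω → ℝ) (T : Set Source) : MeasurableSpace Ω :=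
  ⨆ s ∈ T, MeasurableSpace.comap (ξ s) inferInstance

variable {ξ : Source → Ω → ℝ}

lemma sourceAlg_mono {S T : Set Source} (h : S ⊆ T) : sourceAlg ξ S ≤ sourceAlg ξ T :=
  biSup_mono h

lemma measurable_source {T : Set Source} {s : Source} (hs : s ∈ T) :
    Measurable[sourceAlg ξ T] (ξ s) :=
  Measurable.of_comap_le
    (le_biSup (fun s => MeasurableSpace.comap (ξ s) inferInstance) hs)

lemma sourceAlg_singleton (s : Source) :
    sourceAlg ξ {s} = MeasurableSpace.comap (ξ s) inferInstance := by
  simp [sourceAlg]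

variable {mΩ : MeasurableSpace Ω} {μ : Measure Ω} {σ₀ σ₁ σ₂ : ℝ≥0}

namespace IsNoise

lemma sourceAlg_le (h : IsNoise μ σ₀ σ₁ σ₂ ξ) (T : Set Source) : sourceAlg ξ T ≤ mΩ :=
  iSup₂_le fun s _ => (h.measurable s).comap_le

lemma indep_sourceAlg (h : IsNoise μ σ₀ σ₁ σ₂ ξ) {S T : Set Source} (hST : Disjoint S T) :
    Indep (sourceAlg ξ S) (sourceAlg ξ T) μ :=
  indep_iSup_of_disjoint (fun s => (h.measurable s).comap_le) h.indep hST

lemma hasGaussianLaw (h : IsNoise μ σ₀ σ₁ σ₂ ξ) (s : Source) : HasGaussianLaw (ξ s) μ where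
  isGaussian_map := by rw [h.law s]; infer_instance

lemma integral_eq_zero (h : IsNoise μ σ₀ σ₁ σ₂ ξ) (s : Source) : ∫ ω, ξ s ω ∂μ = 0 := by
  have := integral_map (h.measurable s).aemeasurable (f := fun x : ℝ => x)
    aestronglyMeasurable_id (μ := μ)
  rw [← this, h.law s, integral_id_gaussianReal]

lemma integral_sq (h : IsNoise μ σ₀ σ₁ σ₂ ξ) (s : Source) :
    ∫ ω, ξ s ω ^ 2 ∂μ = sourceVar σ₀ σ₁ σ₂ s := by
  rw [← variance_of_integral_eq_zero (h.measurable s).aemeasurable (h.integral_eq_zero s),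
    ← variance_id_map (h.measurable s).aemeasurable, h.law s, variance_id_gaussianReal]

end IsNoise

end Sources

/-! ### The closed loop -/

/-- The data of a closed loop: the primitive variables, the gain of the plant and the two
strategies. -/
structure ClosedLoop (Ω : Type*) where
  /-- the primitive random variables -/
  ξ : Source → Ω → ℝ
  /-- the gain of the plant -/
  a : ℝ
  /-- the strategy of the first controller -/
  f₁ : Strategy
  /-- the strategy of the second controller -/
  f₂ : Strategy

namespace ClosedLoop

variable {Ω : Type*} (C : ClosedLoop Ω)

/-- The state at time `n`. -/
def x (n : ℕ) (ω : Ω) : ℝ := state C.a C.f₁ C.f₂ (fun s => C.ξ s ω) n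

/-- The observation of the first controller at time `n`. -/
def y₁ (n : ℕ) (ω : Ω) : ℝ := C.x n ω + C.ξ (.v1 n) ω

/-- The observation of the second controller at time `n`. -/
def y₂ (n : ℕ) (ω : Ω) : ℝ := C.x n ω + C.ξ (.v2 n) ω

/-- The input of the first controller at time `n`. -/
def u₁ (n : ℕ) (ω : Ω) : ℝ := input1 C.a C.f₁ C.f₂ (fun s => C.ξ s ω) n

/-- The input of the second controller at time `n`. -/
def u₂ (n : ℕ) (ω : Ω) : ℝ := input2 C.a C.f₁ C.f₂ (fun s => C.ξ s ω) n

/-- The state at time `n + 1` before the disturbance `w[n]` is added. -/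
def pre (n : ℕ) (ω : Ω) : ℝ := C.a * C.x n ω + C.u₁ n ω + C.u₂ n ω

lemma x_succ (n : ℕ) (ω : Ω) : C.x (n + 1) ω = C.pre n ω + C.ξ (.w n) ω := by
  simp only [x, pre, u₁, u₂, input1, input2]
  rw [state]

lemma measurable_u₁ {m : MeasurableSpace Ω} {n : ℕ} (h : ∀ j ≤ n, Measurable[m] (C.y₁ j)) :
    Measurable[m] (C.u₁ n) :=
  (C.f₁.measurable_map n).comp
    (measurable_pi_lambda _ fun j : Fin (n + 1) => h j (Nat.lt_succ_iff.1 j.2))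

lemma measurable_u₂ {m : MeasurableSpace Ω} {n : ℕ} (h : ∀ j ≤ n, Measurable[m] (C.y₂ j)) :
    Measurable[m] (C.u₂ n) :=
  (C.f₂.measurable_map n).comp
    (measurable_pi_lambda _ fun j : Fin (n + 1) => h j (Nat.lt_succ_iff.1 j.2))

lemma v1_mem_present {j n : ℕ} (h : j ≤ n) : Source.v1 j ∈ present n :=
  ⟨by simpa [past, Source.onset] using h, by simp⟩

lemma v2_mem_present {j n : ℕ} (h : j ≤ n) : Source.v2 j ∈ present n :=
  ⟨by simpa [past, Source.onset] using h, by simp⟩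

lemma w_mem_past (n : ℕ) : Source.w n ∈ past (n + 1) := by simp [past, Source.onset]

lemma measurable_x (n : ℕ) : Measurable[sourceAlg C.ξ (past n)] (C.x n) := by
  induction n using Nat.strong_induction_on with
  | _ n ih =>
    cases n with
    | zero =>
      have e : C.x 0 = C.ξ .state0 := by
        funext ω
        rw [x, state]
      rw [e]
      exact measurable_source (Nat.le_refl 0)
    | succ n =>
      have hx : ∀ i ≤ n, Measurable[sourceAlg C.ξ (past (n + 1))] (C.x i) := fun i hi =>
        (ih i (by omega)).mono (sourceAlg_mono (past_mono (by omega))) le_rfl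
      have h₁ : Measurable[sourceAlg C.ξ (past (n + 1))] (C.u₁ n) := C.measurable_u₁ fun i hi =>
        (hx i hi).add (measurable_source (present_subset_past n (v1_mem_present hi)))
      have h₂ : Measurable[sourceAlg C.ξ (past (n + 1))] (C.u₂ n) := C.measurable_u₂ fun i hi =>
        (hx i hi).add (measurable_source (present_subset_past n (v2_mem_present hi)))
      have e : C.x (n + 1) = fun ω => C.pre n ω + C.ξ (.w n) ω := funext (C.x_succ n)
      rw [e]
      exact ((((hx n le_rfl).const_mul C.a).add h₁).add h₂).add (measurable_source (w_mem_past n))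

lemma measurable_x_present {j n : ℕ} (h : j ≤ n) :
    Measurable[sourceAlg C.ξ (present n)] (C.x j) :=
  (C.measurable_x j).mono (sourceAlg_mono ((past_mono h).trans (past_subset_present n))) le_rfl

lemma measurable_y₁_present {j n : ℕ} (h : j ≤ n) :
    Measurable[sourceAlg C.ξ (present n)] (C.y₁ j) :=
  (C.measurable_x_present h).add (measurable_source (v1_mem_present h))

lemma measurable_y₂_present {j n : ℕ} (h : j ≤ n) :
    Measurable[sourceAlg C.ξ (present n)] (C.y₂ j) :=
  (C.measurable_x_present h).add (measurable_source (v2_mem_present h))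

lemma measurable_u₁_present (n : ℕ) : Measurable[sourceAlg C.ξ (present n)] (C.u₁ n) :=
  C.measurable_u₁ fun _ hj => C.measurable_y₁_present hj

lemma measurable_u₂_present (n : ℕ) : Measurable[sourceAlg C.ξ (present n)] (C.u₂ n) :=
  C.measurable_u₂ fun _ hj => C.measurable_y₂_present hj

lemma measurable_pre (n : ℕ) : Measurable[sourceAlg C.ξ (present n)] (C.pre n) :=
  (((C.measurable_x_present le_rfl).const_mul C.a).add (C.measurable_u₁_present n)).add
    (C.measurable_u₂_present n)

end ClosedLoop

/-! ### Innovations and the Kalman filter -/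

/-- The state at time `n` splits as `X` plus a quantity known from the information `F`, where `X`
is a centred Gaussian variable of variance `V` independent of `F`, and `F` contains all
observations made before time `n`. The disturbances and noises up to that time may be in `F` too, as
long as `X` stays independent of it. -/
structure IsInnovation {Ω : Type*} {mΩ : MeasurableSpace Ω} (C : ClosedLoop Ω) (μ : Measure Ω)
    (n : ℕ) (V : ℝ) (X : Ω → ℝ) (F : MeasurableSpace Ω) : Prop where
  info_le : F ≤ sourceAlg C.ξ (past n)
  measurable : Measurable[sourceAlg C.ξ (past n)] X
  gaussian : HasGaussianLaw X μ
  mean : ∫ ω, X ω ∂μ = 0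
  var : ∫ ω, X ω * X ω ∂μ = V
  indep : Indep F (MeasurableSpace.comap X inferInstance) μ
  measurable_rest : Measurable[F] (fun ω => C.x n ω - X ω)
  measurable_y₁ : ∀ j < n, Measurable[F] (C.y₁ j)
  measurable_y₂ : ∀ j < n, Measurable[F] (C.y₂ j)

lemma v1_notMem_past (n : ℕ) : Source.v1 n ∉ past n := by simp [past, Source.onset]
lemma v2_notMem_past (n : ℕ) : Source.v2 n ∉ past n := by simp [past, Source.onset]

lemma disjoint_past_noise (n : ℕ) : Disjoint (past n) {.v1 n, .v2 n} := by
  rw [Set.disjoint_left]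
  rintro s hs (rfl | rfl)
  exacts [v1_notMem_past n hs, v2_notMem_past n hs]

lemma disjoint_present_w (n : ℕ) : Disjoint (present n) {.w n} := Set.disjoint_sdiff_left

/-- The information `F` together with the two observations `X + v₁[n]`, `X + v₂[n]`. -/
@[reducible]
def observed {Ω : Type*} (C : ClosedLoop Ω) (n : ℕ) (X : Ω → ℝ) (F : MeasurableSpace Ω) :
    MeasurableSpace Ω :=
  (MeasurableSpace.comap (comb X (C.ξ (.v1 n)) (C.ξ (.v2 n)) 1 1 0) inferInstance
    ⊔ MeasurableSpace.comap (comb X (C.ξ (.v1 n)) (C.ξ (.v2 n)) 1 0 1) inferInstance) ⊔ F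

variable {Ω : Type*} {F : MeasurableSpace Ω} {mΩ : MeasurableSpace Ω} {μ : Measure Ω}
  {σ₀ σ₁ σ₂ : ℝ≥0} {C : ClosedLoop Ω} {n : ℕ} {V : ℝ} {X : Ω → ℝ}

lemma measurable_comb {m : MeasurableSpace Ω} {X A B : Ω → ℝ} (hX : Measurable[m] X)
    (hA : Measurable[m] A) (hB : Measurable[m] B) (c₀ c₁ c₂ : ℝ) :
    Measurable[m] (comb X A B c₀ c₁ c₂) :=
  ((hX.const_mul c₀).add (hA.const_mul c₁)).add (hB.const_mul c₂)

namespace IsInnovation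

lemma triple [IsProbabilityMeasure μ] (hN : IsNoise μ σ₀ σ₁ σ₂ C.ξ)
    (h : IsInnovation C μ n V X F) :
    IsGaussianTriple μ X (C.ξ (.v1 n)) (C.ξ (.v2 n)) V ((σ₁ : ℝ) ^ 2) ((σ₂ : ℝ) ^ 2) := by
  have hXm : Measurable[mΩ] X := h.measurable.mono (hN.sourceAlg_le _) le_rfl
  have i₁ : Indep (MeasurableSpace.comap X inferInstance)
      (sourceAlg C.ξ {.v1 n, .v2 n}) μ :=
    indep_of_indep_of_le_left (hN.indep_sourceAlg (disjoint_past_noise n)) h.measurable.comap_le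
  have i₂ : IndepFun (C.ξ (.v1 n)) (C.ξ (.v2 n)) μ := hN.indep.indepFun (by simp)
  have m₁ : Measurable[sourceAlg C.ξ {.v1 n, .v2 n}] (C.ξ (.v1 n)) :=
    measurable_source (by simp)
  have m₂ : Measurable[sourceAlg C.ξ {.v1 n, .v2 n}] (C.ξ (.v2 n)) :=
    measurable_source (by simp)
  have v (s : Source) : ∫ ω, C.ξ s ω * C.ξ s ω ∂μ = sourceVar σ₀ σ₁ σ₂ s := by
    simp_rw [← pow_two]
    exact hN.integral_sq s
  refine ⟨?_, h.mean, hN.integral_eq_zero _, hN.integral_eq_zero _, h.var, ?_, ?_, ?_, ?_, ?_⟩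
  · refine IndepFun.hasGaussianLaw h.gaussian
      (IndepFun.hasGaussianLaw (hN.hasGaussianLaw _) (hN.hasGaussianLaw _) i₂) ?_
    rw [IndepFun_iff_Indep]
    exact indep_of_indep_of_le_right i₁ (m₁.prodMk m₂).comap_le
  · rw [v]; simp [sourceVar]
  · rw [v]; simp [sourceVar]
  · exact integral_mul_eq_zero_of_indep (hN.sourceAlg_le _) hXm i₁ h.mean m₁
  · exact integral_mul_eq_zero_of_indep (hN.sourceAlg_le _) hXm i₁ h.mean m₂
  · rw [i₂.integral_fun_mul_eq_mul_integral (hN.measurable _).aestronglyMeasurable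
      (hN.measurable _).aestronglyMeasurable, hN.integral_eq_zero, zero_mul]

/-- A combination of the innovation and the observation noises that is uncorrelated with two
others is independent of these and of the information `F`. -/
lemma indep_comb [IsProbabilityMeasure μ] (hN : IsNoise μ σ₀ σ₁ σ₂ C.ξ)
    (h : IsInnovation C μ n V X F) {e₀ e₁ e₂ c₀ c₁ c₂ d₀ d₁ d₂ : ℝ}
    (hc : e₀ * c₀ * V + e₁ * c₁ * σ₁ ^ 2 + e₂ * c₂ * σ₂ ^ 2 = 0)
    (hd : e₀ * d₀ * V + e₁ * d₁ * σ₁ ^ 2 + e₂ * d₂ * σ₂ ^ 2 = 0) :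
    Indep (MeasurableSpace.comap (comb X (C.ξ (.v1 n)) (C.ξ (.v2 n)) e₀ e₁ e₂) inferInstance)
      ((MeasurableSpace.comap (comb X (C.ξ (.v1 n)) (C.ξ (.v2 n)) c₀ c₁ c₂) inferInstance
        ⊔ MeasurableSpace.comap (comb X (C.ξ (.v1 n)) (C.ξ (.v2 n)) d₀ d₁ d₂) inferInstance) ⊔ F)
      μ := by
  have hXm : Measurable[mΩ] X := h.measurable.mono (hN.sourceAlg_le _) le_rfl
  have hF : F ≤ mΩ := h.info_le.trans (hN.sourceAlg_le _)
  have i : Indep F (MeasurableSpace.comap X inferInstance ⊔ sourceAlg C.ξ {.v1 n, .v2 n}) μ := by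
    refine indep_sup_of_indep_sup hF hXm.comap_le (hN.sourceAlg_le _) h.indep ?_
    exact indep_of_indep_of_le_left (hN.indep_sourceAlg (disjoint_past_noise n))
      (sup_le h.info_le h.measurable.comap_le)
  have mc (c₀ c₁ c₂ : ℝ) : MeasurableSpace.comap
      (comb X (C.ξ (.v1 n)) (C.ξ (.v2 n)) c₀ c₁ c₂) inferInstance
      ≤ MeasurableSpace.comap X inferInstance ⊔ sourceAlg C.ξ {.v1 n, .v2 n} := by
    refine (measurable_comb ?_ ?_ ?_ c₀ c₁ c₂).comap_le
    · exact (comap_measurable X).mono le_sup_left le_rfl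
    · exact (measurable_source (by simp)).mono le_sup_right le_rfl
    · exact (measurable_source (by simp)).mono le_sup_right le_rfl
  have mm : ∀ c₀ c₁ c₂ : ℝ, MeasurableSpace.comap
      (comb X (C.ξ (.v1 n)) (C.ξ (.v2 n)) c₀ c₁ c₂) inferInstance ≤ mΩ := fun c₀ c₁ c₂ =>
    (mc c₀ c₁ c₂).trans (sup_le hXm.comap_le (hN.sourceAlg_le _))
  refine indep_sup_of_indep_sup (mm _ _ _) (sup_le (mm _ _ _) (mm _ _ _)) hF
    ((h.triple hN).indep_comb hc hd) ?_
  exact indep_of_indep_of_le_left i.symm (sup_le (mc _ _ _) (sup_le (mc _ _ _) (mc _ _ _)))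

lemma observed_le (h : IsInnovation C μ n V X F) :
    observed C n X F ≤ sourceAlg C.ξ (present n) := by
  have hX : Measurable[sourceAlg C.ξ (present n)] X :=
    h.measurable.mono (sourceAlg_mono (past_subset_present n)) le_rfl
  have h₁ : Measurable[sourceAlg C.ξ (present n)] (C.ξ (.v1 n)) :=
    measurable_source (ClosedLoop.v1_mem_present le_rfl)
  have h₂ : Measurable[sourceAlg C.ξ (present n)] (C.ξ (.v2 n)) :=
    measurable_source (ClosedLoop.v2_mem_present le_rfl)
  exact sup_le (sup_le (measurable_comb hX h₁ h₂ _ _ _).comap_le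
    (measurable_comb hX h₁ h₂ _ _ _).comap_le)
    (h.info_le.trans (sourceAlg_mono (past_subset_present n)))

/-- The first input depends only on the information `F` and the observation `X + v₁[n]`. -/
lemma measurable_u₁ (h : IsInnovation C μ n V X F) {G : MeasurableSpace Ω} (hFG : F ≤ G)
    (hG : Measurable[G] (comb X (C.ξ (.v1 n)) (C.ξ (.v2 n)) 1 1 0)) :
    (∀ j ≤ n, Measurable[G] (C.y₁ j)) ∧ Measurable[G] (C.u₁ n) := by
  have hy : ∀ j ≤ n, Measurable[G] (C.y₁ j) := by
    intro j hj
    rcases hj.lt_or_eq with hj | rfl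
    · exact (h.measurable_y₁ j hj).mono hFG le_rfl
    · have e : C.y₁ j = fun ω => (C.x j ω - X ω)
          + comb X (C.ξ (.v1 j)) (C.ξ (.v2 j)) 1 1 0 ω := by
        funext ω
        simp only [ClosedLoop.y₁, comb]
        ring
      rw [e]
      exact (h.measurable_rest.mono hFG le_rfl).add hG
  exact ⟨hy, C.measurable_u₁ hy⟩

/-- The second input depends only on the information `F` and the observation `X + v₂[n]`. -/
lemma measurable_u₂ (h : IsInnovation C μ n V X F) {G : MeasurableSpace Ω} (hFG : F ≤ G)
    (hG : Measurable[G] (comb X (C.ξ (.v1 n)) (C.ξ (.v2 n)) 1 0 1)) :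
    (∀ j ≤ n, Measurable[G] (C.y₂ j)) ∧ Measurable[G] (C.u₂ n) := by
  have hy : ∀ j ≤ n, Measurable[G] (C.y₂ j) := by
    intro j hj
    rcases hj.lt_or_eq with hj | rfl
    · exact (h.measurable_y₂ j hj).mono hFG le_rfl
    · have e : C.y₂ j = fun ω => (C.x j ω - X ω)
          + comb X (C.ξ (.v1 j)) (C.ξ (.v2 j)) 1 0 1 ω := by
        funext ω
        simp only [ClosedLoop.y₂, comb]
        ring
      rw [e]
      exact (h.measurable_rest.mono hFG le_rfl).add hG
  exact ⟨hy, C.measurable_u₂ hy⟩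

/-- Up to a quantity known after the observations at time `n`, the state before the next
disturbance is `a` times the estimation error of the innovation. -/
lemma measurable_pre_sub (h : IsInnovation C μ n V X F) (c₁ c₂ : ℝ) :
    Measurable[observed C n X F] (fun ω => C.pre n ω
      - C.a * comb X (C.ξ (.v1 n)) (C.ξ (.v2 n)) (1 - c₁ - c₂) (-c₁) (-c₂) ω) := by
  have g₁ : Measurable[observed C n X F] (comb X (C.ξ (.v1 n)) (C.ξ (.v2 n)) 1 1 0) :=
    (comap_measurable _).mono (le_sup_left.trans le_sup_left) le_rfl
  have g₂ : Measurable[observed C n X F] (comb X (C.ξ (.v1 n)) (C.ξ (.v2 n)) 1 0 1) :=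
    (comap_measurable _).mono (le_sup_right.trans le_sup_left) le_rfl
  have e : (fun ω => C.pre n ω
      - C.a * comb X (C.ξ (.v1 n)) (C.ξ (.v2 n)) (1 - c₁ - c₂) (-c₁) (-c₂) ω) = fun ω =>
      C.a * (C.x n ω - X ω) + C.a * c₁ * comb X (C.ξ (.v1 n)) (C.ξ (.v2 n)) 1 1 0 ω
        + C.a * c₂ * comb X (C.ξ (.v1 n)) (C.ξ (.v2 n)) 1 0 1 ω + C.u₁ n ω + C.u₂ n ω := by
    funext ω
    simp only [ClosedLoop.pre, comb]
    ring
  rw [e]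
  exact (((((h.measurable_rest.mono le_sup_right le_rfl).const_mul _).add
    (g₁.const_mul _)).add (g₂.const_mul _)).add (h.measurable_u₁ le_sup_right g₁).2).add
    (h.measurable_u₂ le_sup_right g₂).2

/-- The centralized bound: no use of the two observations makes the second moment of the state
smaller than `a²` times the variance of the estimation error. -/
lemma le_integral_pre_sq [IsProbabilityMeasure μ] (hN : IsNoise μ σ₀ σ₁ σ₂ C.ξ)
    (h : IsInnovation C μ n V X F) (hS : MemLp (C.pre n) 2 μ) {c₁ c₂ : ℝ}
    (h₁ : (1 - c₁ - c₂) * V = c₁ * σ₁ ^ 2) (h₂ : (1 - c₁ - c₂) * V = c₂ * σ₂ ^ 2) :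
    C.a ^ 2 * ((1 - c₁ - c₂) ^ 2 * V + c₁ ^ 2 * σ₁ ^ 2 + c₂ ^ 2 * σ₂ ^ 2)
      ≤ ∫ ω, C.pre n ω ^ 2 ∂μ := by
  have ht := h.triple hN
  set E := comb X (C.ξ (.v1 n)) (C.ξ (.v2 n)) (1 - c₁ - c₂) (-c₁) (-c₂) with hE
  have hEL : MemLp (fun ω => C.a * E ω) 2 μ := (ht.memLp_comb _ _ _).const_mul C.a
  have hEm : Measurable[mΩ] E := measurable_comb (h.measurable.mono (hN.sourceAlg_le _) le_rfl)
    (hN.measurable _) (hN.measurable _) _ _ _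
  have hi : Indep (MeasurableSpace.comap E inferInstance) (observed C n X F) μ :=
    h.indep_comb hN (by linear_combination h₁) (by linear_combination h₂)
  have hi' : Indep (MeasurableSpace.comap (fun ω => C.a * E ω) inferInstance)
      (observed C n X F) μ :=
    indep_of_indep_of_le_left hi ((comap_measurable E).const_mul C.a).comap_le
  have key := integral_add_sq_of_indep (h.observed_le.trans (hN.sourceAlg_le _))
    (hEm.const_mul C.a) hEL (hS.sub hEL) hi'
    (by rw [integral_const_mul, ht.integral_comb, mul_zero]) (h.measurable_pre_sub c₁ c₂)
  have e : ∀ ω, C.a * E ω + (C.pre n - fun ω => C.a * E ω) ω = C.pre n ω := fun ω => by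
    simp
  simp_rw [e] at key
  rw [key]
  have : ∫ ω, (C.a * E ω) ^ 2 ∂μ
      = C.a ^ 2 * ((1 - c₁ - c₂) ^ 2 * V + c₁ ^ 2 * σ₁ ^ 2 + c₂ ^ 2 * σ₂ ^ 2) := by
    simp_rw [mul_pow]
    rw [integral_const_mul, hE, ht.integral_comb_sq]
    ring
  rw [this]
  exact le_add_of_nonneg_right (integral_nonneg fun ω => sq_nonneg _)

/-- One step of the Kalman filter: the estimation error of the innovation, amplified by `a`, is the
next innovation, relative to the information enlarged by the two observations and `w[n]`. -/
lemma succ [IsProbabilityMeasure μ] (hN : IsNoise μ σ₀ σ₁ σ₂ C.ξ)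
    (h : IsInnovation C μ n V X F) {c₁ c₂ : ℝ}
    (h₁ : (1 - c₁ - c₂) * V = c₁ * σ₁ ^ 2) (h₂ : (1 - c₁ - c₂) * V = c₂ * σ₂ ^ 2) :
    ∃ X' F', IsInnovation C μ (n + 1)
      (C.a ^ 2 * ((1 - c₁ - c₂) ^ 2 * V + c₁ ^ 2 * σ₁ ^ 2 + c₂ ^ 2 * σ₂ ^ 2)) X' F' := by
  have ht := h.triple hN
  set E := comb X (C.ξ (.v1 n)) (C.ξ (.v2 n)) (1 - c₁ - c₂) (-c₁) (-c₂) with hE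
  have hEm : Measurable[sourceAlg C.ξ (present n)] E :=
    measurable_comb (h.measurable.mono (sourceAlg_mono (past_subset_present n)) le_rfl)
      (measurable_source (ClosedLoop.v1_mem_present le_rfl))
      (measurable_source (ClosedLoop.v2_mem_present le_rfl)) _ _ _
  have hi : Indep (MeasurableSpace.comap E inferInstance) (observed C n X F) μ :=
    h.indep_comb hN (by linear_combination h₁) (by linear_combination h₂)
  have hw : Indep (MeasurableSpace.comap E inferInstance)
      (observed C n X F ⊔ sourceAlg C.ξ {.w n}) μ := by
    refine indep_sup_of_indep_sup (hEm.comap_le.trans (hN.sourceAlg_le _))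
      (h.observed_le.trans (hN.sourceAlg_le _)) (hN.sourceAlg_le _) hi ?_
    exact indep_of_indep_of_le_left (hN.indep_sourceAlg (disjoint_present_w n))
      (sup_le hEm.comap_le h.observed_le)
  have hwm : Measurable[sourceAlg C.ξ {.w n}] (C.ξ (.w n)) :=
    measurable_source (Set.mem_singleton _)
  have g₁ : Measurable[observed C n X F] (comb X (C.ξ (.v1 n)) (C.ξ (.v2 n)) 1 1 0) :=
    (comap_measurable _).mono (le_sup_left.trans le_sup_left) le_rfl
  have g₂ : Measurable[observed C n X F] (comb X (C.ξ (.v1 n)) (C.ξ (.v2 n)) 1 0 1) :=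
    (comap_measurable _).mono (le_sup_right.trans le_sup_left) le_rfl
  refine ⟨fun ω => C.a * E ω, observed C n X F ⊔ sourceAlg C.ξ {.w n}, ?_, ?_, ?_, ?_, ?_, ?_,
    ?_, ?_, ?_⟩
  · refine sup_le (h.observed_le.trans (sourceAlg_mono (present_subset_past n)))
      (sourceAlg_mono ?_)
    rintro _ rfl
    exact ClosedLoop.w_mem_past n
  · exact (hEm.mono (sourceAlg_mono (present_subset_past n)) le_rfl).const_mul C.a
  · exact (ht.hasGaussianLaw_comb _ _ _).fun_smul C.a
  · rw [integral_const_mul, ht.integral_comb, mul_zero]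
  · have e : ∀ ω, C.a * E ω * (C.a * E ω) = C.a ^ 2 * E ω ^ 2 := fun ω => by ring
    simp_rw [e]
    rw [integral_const_mul, hE, ht.integral_comb_sq]
    ring
  · exact (indep_of_indep_of_le_left hw ((comap_measurable E).const_mul C.a).comap_le).symm
  · have e : (fun ω => C.x (n + 1) ω - C.a * E ω)
        = fun ω => (C.pre n ω - C.a * E ω) + C.ξ (.w n) ω := by
      funext ω
      rw [C.x_succ]
      ring
    rw [e]
    exact ((h.measurable_pre_sub c₁ c₂).mono le_sup_left le_rfl).add
      (hwm.mono le_sup_right le_rfl)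
  · exact fun j hj => ((h.measurable_u₁ le_sup_right g₁).1 j (Nat.lt_succ_iff.1 hj)).mono
      le_sup_left le_rfl
  · exact fun j hj => ((h.measurable_u₂ le_sup_right g₂).1 j (Nat.lt_succ_iff.1 hj)).mono
      le_sup_left le_rfl

lemma memLp_rest (h : IsInnovation C μ n V X F) (hx : MemLp (C.x n) 2 μ) :
    MemLp (fun ω => C.x n ω - X ω) 2 μ := hx.sub h.gaussian.memLp_two

/-- No control can remove the innovation from the state. -/
lemma le_integral_x_sq (hN : IsNoise μ σ₀ σ₁ σ₂ C.ξ) (h : IsInnovation C μ n V X F)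
    (hx : MemLp (C.x n) 2 μ) : V ≤ ∫ ω, C.x n ω ^ 2 ∂μ := by
  have key := integral_add_sq_of_indep (h.info_le.trans (hN.sourceAlg_le _))
    (h.measurable.mono (hN.sourceAlg_le _) le_rfl) h.gaussian.memLp_two (h.memLp_rest hx)
    h.indep.symm h.mean h.measurable_rest
  simp_rw [add_sub_cancel] at key
  rw [key, ← h.var]
  simp_rw [← pow_two]
  exact le_add_of_nonneg_right (integral_nonneg fun ω => sq_nonneg _)

end IsInnovation

/-- The disturbance `w[n]` is an innovation of the state at time `n + 1`. -/
lemma isInnovation_w (hN : IsNoise μ σ₀ σ₁ σ₂ C.ξ) (n : ℕ) :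
    IsInnovation C μ (n + 1) 1 (C.ξ (.w n)) (sourceAlg C.ξ (present n)) where
  info_le := sourceAlg_mono (present_subset_past n)
  measurable := measurable_source (ClosedLoop.w_mem_past n)
  gaussian := hN.hasGaussianLaw _
  mean := hN.integral_eq_zero _
  var := by
    simp_rw [← pow_two]
    rw [hN.integral_sq]
    simp [sourceVar]
  indep := by
    rw [← sourceAlg_singleton]
    exact hN.indep_sourceAlg (disjoint_present_w n)
  measurable_rest := by
    simp_rw [C.x_succ, add_sub_cancel_right]
    exact C.measurable_pre n
  measurable_y₁ := fun _ hj => C.measurable_y₁_present (Nat.lt_succ_iff.1 hj)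
  measurable_y₂ := fun _ hj => C.measurable_y₂_present (Nat.lt_succ_iff.1 hj)

lemma integral_x_succ_sq (hN : IsNoise μ σ₀ σ₁ σ₂ C.ξ) (n : ℕ) (hS : MemLp (C.pre n) 2 μ) :
    ∫ ω, C.x (n + 1) ω ^ 2 ∂μ = ∫ ω, C.pre n ω ^ 2 ∂μ + 1 := by
  have h := isInnovation_w hN n
  have key := integral_add_sq_of_indep (hN.sourceAlg_le _) (hN.measurable (.w n))
    h.gaussian.memLp_two hS h.indep.symm h.mean (C.measurable_pre n)
  simp_rw [C.x_succ, add_comm (C.pre n _)]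
  rw [key, hN.integral_sq]
  simp [sourceVar, add_comm]

/-! ### Optimality of linear inputs in one step -/

section Team

variable {Ω : Type*} {F : MeasurableSpace Ω} {mΩ : MeasurableSpace Ω} {μ : Measure Ω}
  {σ₀ σ₁ σ₂ : ℝ≥0} {C : ClosedLoop Ω} {n : ℕ} {V : ℝ} {X : Ω → ℝ}

namespace IsInnovation

lemma var_nonneg (h : IsInnovation C μ n V X F) : 0 ≤ V := by
  rw [← h.var]
  exact integral_nonneg fun ω => mul_self_nonneg _

/-- An input `U` that depends on the information `F` and one linear observation `Y` acts on the
Gaussian variables at time `n` as the linear input `-c Y`: the difference `U + c Y` is orthogonal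
to all of them. -/
lemma exists_gain [IsProbabilityMeasure μ] (hN : IsNoise μ σ₀ σ₁ σ₂ C.ξ)
    (h : IsInnovation C μ n V X F) (d₁ d₂ : ℝ) {U : Ω → ℝ} (hU : MemLp U 2 μ)
    (hUm : Measurable[MeasurableSpace.comap (comb X (C.ξ (.v1 n)) (C.ξ (.v2 n)) 1 d₁ d₂)
      inferInstance ⊔ F] U) :
    ∃ c : ℝ, c ^ 2 * (V + d₁ ^ 2 * σ₁ ^ 2 + d₂ ^ 2 * σ₂ ^ 2) ≤ ∫ ω, U ω ^ 2 ∂μ ∧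
      ∀ e₀ e₁ e₂ : ℝ, ∫ ω, comb X (C.ξ (.v1 n)) (C.ξ (.v2 n)) e₀ e₁ e₂ ω *
        (U ω + c * comb X (C.ξ (.v1 n)) (C.ξ (.v2 n)) 1 d₁ d₂ ω) ∂μ = 0 := by
  have ht := h.triple hN
  set Y := comb X (C.ξ (.v1 n)) (C.ξ (.v2 n)) 1 d₁ d₂ with hY
  have hYL : MemLp Y 2 μ := ht.memLp_comb _ _ _
  have hV := h.var_nonneg
  set p := V + d₁ ^ 2 * (σ₁ : ℝ) ^ 2 + d₂ ^ 2 * (σ₂ : ℝ) ^ 2 with hp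
  set m := ∫ ω, Y ω * U ω ∂μ with hm
  have hXm : Measurable[mΩ] X := h.measurable.mono (hN.sourceAlg_le _) le_rfl
  have mcomb (c₀ c₁ c₂ : ℝ) : Measurable[mΩ] (comb X (C.ξ (.v1 n)) (C.ξ (.v2 n)) c₀ c₁ c₂) :=
    measurable_comb hXm (hN.measurable _) (hN.measurable _) _ _ _
  have hle : (MeasurableSpace.comap Y inferInstance ⊔ MeasurableSpace.comap Y inferInstance) ⊔ F
      ≤ mΩ := sup_le (sup_le (mcomb _ _ _).comap_le (mcomb _ _ _).comap_le)
        (h.info_le.trans (hN.sourceAlg_le _))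
  have hproj : ∀ e₀ e₁ e₂ : ℝ, ∫ ω, comb X (C.ξ (.v1 n)) (C.ξ (.v2 n)) e₀ e₁ e₂ ω * U ω ∂μ
      = (e₀ * V + e₁ * d₁ * σ₁ ^ 2 + e₂ * d₂ * σ₂ ^ 2) / p * m := by
    intro e₀ e₁ e₂
    set r := e₀ * V + e₁ * d₁ * (σ₁ : ℝ) ^ 2 + e₂ * d₂ * (σ₂ : ℝ) ^ 2 with hr
    set b := r / p with hb
    -- If `Y` is degenerate, then `r = 0` as well, and the division by zero is harmless.
    have hbp : b * p = r := by
      rcases eq_or_ne p 0 with h0 | h0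
      · have k₁ : 0 ≤ d₁ ^ 2 * (σ₁ : ℝ) ^ 2 := by positivity
        have k₂ : 0 ≤ d₂ ^ 2 * (σ₂ : ℝ) ^ 2 := by positivity
        have z₀ : V = 0 := by linarith
        have z₁ : d₁ * (σ₁ : ℝ) = 0 := by
          have : (d₁ * (σ₁ : ℝ)) ^ 2 = 0 := by rw [mul_pow]; linarith
          exact pow_eq_zero_iff (two_ne_zero) |>.1 this
        have z₂ : d₂ * (σ₂ : ℝ) = 0 := by
          have : (d₂ * (σ₂ : ℝ)) ^ 2 = 0 := by rw [mul_pow]; linarith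
          exact pow_eq_zero_iff (two_ne_zero) |>.1 this
        rw [h0, mul_zero, hr, z₀]
        linear_combination (-e₁ * σ₁) * z₁ - e₂ * σ₂ * z₂
      · rw [hb, div_mul_cancel₀ _ h0]
    have hi := h.indep_comb hN (e₀ := e₀ - b) (e₁ := e₁ - b * d₁) (e₂ := e₂ - b * d₂)
      (c₀ := 1) (c₁ := d₁) (c₂ := d₂) (d₀ := 1) (d₁ := d₁) (d₂ := d₂)
      (by linear_combination -hbp + hr + b * hp) (by linear_combination -hbp + hr + b * hp)
    have k := integral_mul_eq_zero_of_indep hle (mcomb _ _ _) hi (ht.integral_comb _ _ _)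
      (hUm.mono (sup_le_sup_right le_sup_left F) le_rfl)
    have e : ∀ ω, comb X (C.ξ (.v1 n)) (C.ξ (.v2 n)) e₀ e₁ e₂ ω * U ω
        = comb X (C.ξ (.v1 n)) (C.ξ (.v2 n)) (e₀ - b) (e₁ - b * d₁) (e₂ - b * d₂) ω * U ω
          + b * (Y ω * U ω) := fun ω => by
      simp only [hY, comb]
      ring
    have i₁ : Integrable (fun ω => comb X (C.ξ (.v1 n)) (C.ξ (.v2 n)) (e₀ - b) (e₁ - b * d₁)
        (e₂ - b * d₂) ω * U ω) μ := (ht.memLp_comb _ _ _).integrable_mul hU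
    have i₂ : Integrable (fun ω => b * (Y ω * U ω)) μ := (hYL.integrable_mul hU).const_mul b
    simp_rw [e]
    rw [integral_add i₁ i₂, k, integral_const_mul, zero_add]
  refine ⟨-(m / p), ?_, fun e₀ e₁ e₂ => ?_⟩
  · have hYY : ∫ ω, Y ω ^ 2 ∂μ = p := by
      rw [hY, ht.integral_comb_sq, hp]
      ring
    have hnn : 0 ≤ ∫ ω, (U ω + (-(m / p)) * Y ω) ^ 2 ∂μ := integral_nonneg fun ω => sq_nonneg _
    rw [integral_add_sq hU (hYL.const_mul _)] at hnn
    have e₁ : ∫ ω, U ω * (-(m / p) * Y ω) ∂μ = -(m / p) * m := by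
      rw [hm, ← integral_const_mul]
      exact integral_congr_ae (ae_of_all _ fun ω => by ring)
    have e₂ : ∫ ω, (-(m / p) * Y ω) ^ 2 ∂μ = (-(m / p)) ^ 2 * p := by
      simp_rw [mul_pow]
      rw [integral_const_mul, hYY]
    rw [e₁, e₂] at hnn
    have e₃ : (-(m / p)) ^ 2 * p = m / p * m := by
      rcases eq_or_ne p 0 with h0 | h0
      · simp [h0]
      · field_simp
    rw [e₃] at hnn ⊢
    linarith
  · have e : ∀ ω, comb X (C.ξ (.v1 n)) (C.ξ (.v2 n)) e₀ e₁ e₂ ω * (U ω + -(m / p) * Y ω)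
        = comb X (C.ξ (.v1 n)) (C.ξ (.v2 n)) e₀ e₁ e₂ ω * U ω
          + -(m / p) * (comb X (C.ξ (.v1 n)) (C.ξ (.v2 n)) e₀ e₁ e₂ ω * Y ω) := fun ω => by ring
    have i₁ : Integrable (fun ω => comb X (C.ξ (.v1 n)) (C.ξ (.v2 n)) e₀ e₁ e₂ ω * U ω) μ :=
      (ht.memLp_comb _ _ _).integrable_mul hU
    have i₂ : Integrable (fun ω => -(m / p) *
        (comb X (C.ξ (.v1 n)) (C.ξ (.v2 n)) e₀ e₁ e₂ ω * Y ω)) μ :=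
      ((ht.memLp_comb _ _ _).integrable_mul hYL).const_mul _
    simp_rw [e]
    rw [integral_add i₁ i₂, integral_const_mul, hproj, hY,
      ht.integral_comb_mul_comb]
    ring

/-- Linear inputs are optimal for one step of the team problem: the second moment of the state
before the next disturbance is at least the one that some linear gains with the same powers
achieve on the innovation. -/
lemma exists_linear_gains [IsProbabilityMeasure μ] (hN : IsNoise μ σ₀ σ₁ σ₂ C.ξ)
    (h : IsInnovation C μ n V X F) (hx : MemLp (C.x n) 2 μ) (hu₁ : MemLp (C.u₁ n) 2 μ)
    (hu₂ : MemLp (C.u₂ n) 2 μ) :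
    ∃ c₁ c₂ : ℝ, c₁ ^ 2 * (V + σ₁ ^ 2) ≤ ∫ ω, C.u₁ n ω ^ 2 ∂μ ∧
      c₂ ^ 2 * (V + σ₂ ^ 2) ≤ ∫ ω, C.u₂ n ω ^ 2 ∂μ ∧
      (C.a - c₁ - c₂) ^ 2 * V + c₁ ^ 2 * σ₁ ^ 2 + c₂ ^ 2 * σ₂ ^ 2
        ≤ ∫ ω, C.pre n ω ^ 2 ∂μ := by
  have ht := h.triple hN
  obtain ⟨c₁, hp₁, ho₁⟩ := h.exists_gain hN 1 0 hu₁ (h.measurable_u₁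
    (G := MeasurableSpace.comap (comb X (C.ξ (.v1 n)) (C.ξ (.v2 n)) 1 1 0) inferInstance ⊔ F)
    le_sup_right ((comap_measurable _).mono le_sup_left le_rfl)).2
  obtain ⟨c₂, hp₂, ho₂⟩ := h.exists_gain hN 0 1 hu₂ (h.measurable_u₂
    (G := MeasurableSpace.comap (comb X (C.ξ (.v1 n)) (C.ξ (.v2 n)) 1 0 1) inferInstance ⊔ F)
    le_sup_right ((comap_measurable _).mono le_sup_left le_rfl)).2
  refine ⟨c₁, c₂, le_trans (le_of_eq (by ring)) hp₁, le_trans (le_of_eq (by ring)) hp₂, ?_⟩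
  set L := comb X (C.ξ (.v1 n)) (C.ξ (.v2 n)) (C.a - c₁ - c₂) (-c₁) (-c₂) with hL
  set Y₁ := comb X (C.ξ (.v1 n)) (C.ξ (.v2 n)) 1 1 0 with hY₁
  set Y₂ := comb X (C.ξ (.v1 n)) (C.ξ (.v2 n)) 1 0 1 with hY₂
  have hLL : MemLp L 2 μ := ht.memLp_comb _ _ _
  have hK := h.memLp_rest hx
  have hR₁ : MemLp (fun ω => C.u₁ n ω + c₁ * Y₁ ω) 2 μ :=
    hu₁.add ((ht.memLp_comb _ _ _).const_mul c₁)
  have hR₂ : MemLp (fun ω => C.u₂ n ω + c₂ * Y₂ ω) 2 μ :=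
    hu₂.add ((ht.memLp_comb _ _ _).const_mul c₂)
  have hi : Indep (MeasurableSpace.comap L inferInstance) F μ :=
    indep_of_indep_of_le_right (h.indep_comb hN (c₀ := 0) (c₁ := 0) (c₂ := 0) (d₀ := 0)
      (d₁ := 0) (d₂ := 0) (by ring) (by ring)) le_sup_right
  have hLm : Measurable[mΩ] L := measurable_comb
    (h.measurable.mono (hN.sourceAlg_le _) le_rfl) (hN.measurable _) (hN.measurable _) _ _ _
  have ho : ∫ ω, L ω * (C.x n ω - X ω) ∂μ = 0 := integral_mul_eq_zero_of_indep
    (h.info_le.trans (hN.sourceAlg_le _)) hLm hi (ht.integral_comb _ _ _) h.measurable_rest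
  have i₀ : Integrable (fun ω => C.a * (L ω * (C.x n ω - X ω))) μ :=
    (hLL.integrable_mul hK).const_mul C.a
  have i₁ : Integrable (fun ω => L ω * (C.u₁ n ω + c₁ * Y₁ ω)) μ := hLL.integrable_mul hR₁
  have i₂ : Integrable (fun ω => L ω * (C.u₂ n ω + c₂ * Y₂ ω)) μ := hLL.integrable_mul hR₂
  have hcross : ∫ ω, L ω * (C.a * (C.x n ω - X ω) + (C.u₁ n ω + c₁ * Y₁ ω)
      + (C.u₂ n ω + c₂ * Y₂ ω)) ∂μ = 0 := by
    have e : ∀ ω, L ω * (C.a * (C.x n ω - X ω) + (C.u₁ n ω + c₁ * Y₁ ω)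
        + (C.u₂ n ω + c₂ * Y₂ ω)) = C.a * (L ω * (C.x n ω - X ω))
        + L ω * (C.u₁ n ω + c₁ * Y₁ ω) + L ω * (C.u₂ n ω + c₂ * Y₂ ω) := fun ω => by ring
    simp_rw [e]
    rw [integral_add (f := fun ω => C.a * (L ω * (C.x n ω - X ω))
      + L ω * (C.u₁ n ω + c₁ * Y₁ ω)) (i₀.add i₁) i₂, integral_add i₀ i₁, integral_const_mul, ho,
      ho₁, ho₂]
    ring
  have hdec : ∀ ω, C.pre n ω = L ω + (C.a * (C.x n ω - X ω) + (C.u₁ n ω + c₁ * Y₁ ω)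
      + (C.u₂ n ω + c₂ * Y₂ ω)) := fun ω => by
    simp only [ClosedLoop.pre, hL, hY₁, hY₂, comb]
    ring
  simp_rw [hdec]
  have hR : MemLp (fun ω => C.a * (C.x n ω - X ω) + (C.u₁ n ω + c₁ * Y₁ ω)
      + (C.u₂ n ω + c₂ * Y₂ ω)) 2 μ := ((hK.const_mul C.a).add hR₁).add hR₂
  rw [integral_add_sq hLL hR, hcross, hL,
    ht.integral_comb_sq, neg_sq, neg_sq, mul_zero, add_zero]
  exact le_add_of_nonneg_right (integral_nonneg fun ω => sq_nonneg _)

end IsInnovation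

end Team

/-! ### Propagation of the state through a window -/

section Propagation

variable {Ω : Type*} {mΩ : MeasurableSpace Ω} {μ : Measure Ω} {σ₀ σ₁ σ₂ : ℝ≥0}
  {C : ClosedLoop Ω}

/-- What `C.pre (m + i)` would be if the inputs vanished at the times `m + 1, …, m + i`. -/
def ClosedLoop.passive (C : ClosedLoop Ω) (m : ℕ) : ℕ → Ω → ℝ
  | 0 => C.pre m
  | i + 1 => fun ω => C.a * (C.passive m i ω + C.ξ (.w (m + i)) ω)

/-- The contribution of the inputs `u[m+1], …, u[m+L]` of one controller to `C.pre (m + L)`. -/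
def drive (a : ℝ) (u : ℕ → Ω → ℝ) (m L : ℕ) (ω : Ω) : ℝ :=
  ∑ j ∈ Finset.range L, a ^ (L - 1 - j) * u (m + 1 + j) ω

lemma drive_succ (a : ℝ) (u : ℕ → Ω → ℝ) (m L : ℕ) (ω : Ω) :
    drive a u m (L + 1) ω = a * drive a u m L ω + u (m + 1 + L) ω := by
  unfold drive
  rw [Finset.sum_range_succ, Finset.mul_sum]
  congr 1
  · refine Finset.sum_congr rfl fun j hj => ?_
    have := Finset.mem_range.1 hj
    rw [show L + 1 - 1 - j = (L - 1 - j) + 1 by omega, pow_succ]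
    ring
  · simp

lemma pre_add_eq (C : ClosedLoop Ω) (m i : ℕ) (ω : Ω) :
    C.pre (m + i) ω = C.passive m i ω + (drive C.a C.u₁ m i ω + drive C.a C.u₂ m i ω) := by
  induction i with
  | zero => simp [ClosedLoop.passive, drive]
  | succ i ih =>
    have e : C.pre (m + (i + 1)) ω = C.a * (C.pre (m + i) ω + C.ξ (.w (m + i)) ω)
        + C.u₁ (m + 1 + i) ω + C.u₂ (m + 1 + i) ω := by
      rw [← C.x_succ, ← add_assoc, add_right_comm m 1 i]
      rfl
    rw [e, ih, drive_succ, drive_succ]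
    simp only [ClosedLoop.passive]
    ring

lemma measurable_passive (C : ClosedLoop Ω) (m i : ℕ) :
    Measurable[sourceAlg C.ξ (present (m + i))] (C.passive m i) := by
  induction i with
  | zero => exact C.measurable_pre m
  | succ i ih =>
    have hsub : past (m + i + 1) ⊆ present (m + (i + 1)) := past_subset_present (m + (i + 1))
    exact ((ih.mono (sourceAlg_mono ((present_subset_past _).trans hsub)) le_rfl).add
      (measurable_source (hsub (ClosedLoop.w_mem_past _)))).const_mul C.a

lemma memLp_passive (hN : IsNoise μ σ₀ σ₁ σ₂ C.ξ) {m : ℕ} (hS : MemLp (C.pre m) 2 μ) (i : ℕ) :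
    MemLp (C.passive m i) 2 μ := by
  induction i with
  | zero => exact hS
  | succ i ih => exact (ih.add (hN.hasGaussianLaw _).memLp_two).const_mul C.a

lemma integral_passive_succ_sq (hN : IsNoise μ σ₀ σ₁ σ₂ C.ξ) {m : ℕ}
    (hS : MemLp (C.pre m) 2 μ) (i : ℕ) :
    ∫ ω, C.passive m (i + 1) ω ^ 2 ∂μ = C.a ^ 2 * (∫ ω, C.passive m i ω ^ 2 ∂μ + 1) := by
  have h := isInnovation_w hN (m + i)
  have key := integral_add_sq_of_indep (hN.sourceAlg_le _) (hN.measurable (.w (m + i)))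
    h.gaussian.memLp_two (memLp_passive hN hS i) h.indep.symm h.mean (measurable_passive C m i)
  simp only [ClosedLoop.passive, mul_pow]
  rw [integral_const_mul]
  simp_rw [add_comm (C.passive m i _)]
  rw [key, hN.integral_sq, add_comm]
  simp [sourceVar]

lemma pow_mul_le_integral_passive_sq (hN : IsNoise μ σ₀ σ₁ σ₂ C.ξ) {m : ℕ}
    (hS : MemLp (C.pre m) 2 μ) (i : ℕ) :
    C.a ^ (2 * i) * ∫ ω, C.pre m ω ^ 2 ∂μ ≤ ∫ ω, C.passive m i ω ^ 2 ∂μ := by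
  induction i with
  | zero => simp [ClosedLoop.passive]
  | succ i ih =>
    rw [integral_passive_succ_sq hN hS]
    calc C.a ^ (2 * (i + 1)) * ∫ ω, C.pre m ω ^ 2 ∂μ
        = C.a ^ 2 * (C.a ^ (2 * i) * ∫ ω, C.pre m ω ^ 2 ∂μ) := by ring
      _ ≤ _ := mul_le_mul_of_nonneg_left (by linarith) (sq_nonneg _)

/-- The contribution of `w[m]` alone. -/
lemma pow_le_integral_passive_succ_sq (hN : IsNoise μ σ₀ σ₁ σ₂ C.ξ) {m : ℕ}
    (hS : MemLp (C.pre m) 2 μ) (i : ℕ) :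
    C.a ^ (2 * (i + 1)) ≤ ∫ ω, C.passive m (i + 1) ω ^ 2 ∂μ := by
  induction i with
  | zero =>
    rw [integral_passive_succ_sq hN hS]
    have : 0 ≤ ∫ ω, C.passive m 0 ω ^ 2 ∂μ := integral_nonneg fun ω => sq_nonneg _
    have h2 := mul_nonneg (sq_nonneg C.a) this
    have e : C.a ^ (2 * (0 + 1)) = C.a ^ 2 := by ring
    linarith
  | succ i ih =>
    rw [integral_passive_succ_sq hN hS]
    calc C.a ^ (2 * (i + 1 + 1)) = C.a ^ 2 * C.a ^ (2 * (i + 1)) := by ring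
      _ ≤ _ := mul_le_mul_of_nonneg_left (by linarith) (sq_nonneg _)

/-- The first factor in the weighted Cauchy–Schwarz inequality `integral_drive_sq_le`. -/
def gainSum (a : ℝ) (L : ℕ) : ℝ := ∑ j ∈ Finset.range L, a ^ (2 * (L - 1 - j)) * 2.5 ^ j

lemma gainSum_nonneg (a : ℝ) (L : ℕ) : 0 ≤ gainSum a L :=
  Finset.sum_nonneg fun j _ => mul_nonneg (by rw [pow_mul]; positivity) (by positivity)

lemma gainSum_succ (a : ℝ) (L : ℕ) : gainSum a (L + 1) = a ^ 2 * gainSum a L + 2.5 ^ L := by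
  unfold gainSum
  rw [Finset.sum_range_succ, Finset.mul_sum]
  congr 1
  · refine Finset.sum_congr rfl fun j hj => ?_
    have := Finset.mem_range.1 hj
    rw [show 2 * (L + 1 - 1 - j) = 2 * (L - 1 - j) + 2 by omega, pow_add]
    ring
  · simp

lemma memLp_drive {u : ℕ → Ω → ℝ} (a : ℝ) {m : ℕ} (hu : ∀ j, MemLp (u j) 2 μ) (L : ℕ) :
    MemLp (drive a u m L) 2 μ :=
  memLp_finsetSum _ fun _ _ => (hu _).const_mul _

/-- Weighted Cauchy–Schwarz inequality for the accumulated effect of the inputs. -/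
lemma integral_drive_sq_le {u : ℕ → Ω → ℝ} (a : ℝ) (m : ℕ) (hu : ∀ j, MemLp (u j) 2 μ)
    (L : ℕ) : ∫ ω, drive a u m L ω ^ 2 ∂μ
      ≤ gainSum a L * ∑ j ∈ Finset.range L, 2.5⁻¹ ^ j * ∫ ω, u (m + 1 + j) ω ^ 2 ∂μ := by
  have hint : ∀ j ∈ Finset.range L, Integrable (fun ω => 2.5⁻¹ ^ j * u (m + 1 + j) ω ^ 2) μ :=
    fun j _ => (hu _).integrable_sq.const_mul _
  calc ∫ ω, drive a u m L ω ^ 2 ∂μ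
      ≤ ∫ ω, gainSum a L * ∑ j ∈ Finset.range L, 2.5⁻¹ ^ j * u (m + 1 + j) ω ^ 2 ∂μ := by
        refine integral_mono (memLp_drive a hu L).integrable_sq
          ((integrable_finsetSum _ hint).const_mul _) fun ω => ?_
        refine Finset.sum_sq_le_sum_mul_sum_of_sq_le_mul _
          (fun j _ => mul_nonneg (by rw [pow_mul]; positivity) (by positivity))
          (fun j _ => by positivity) fun j _ => le_of_eq ?_
        have : (2.5 : ℝ) ^ j * 2.5⁻¹ ^ j = 1 := by rw [← mul_pow]; norm_num
        rw [mul_pow, ← pow_mul, mul_comm (L - 1 - j) 2]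
        linear_combination (-(a ^ (2 * (L - 1 - j)) * u (m + 1 + j) ω ^ 2)) * this
    _ = _ := by
        rw [integral_const_mul, integral_finsetSum _ hint]
        simp_rw [integral_const_mul]

/-- The inputs can reduce the root mean square of the passive state by at most that of their
contributions. -/
lemma sqrt_integral_passive_le (m i : ℕ)
    (hx : ∀ j, MemLp (C.pre j) 2 μ)
    (hu₁ : ∀ j, MemLp (C.u₁ j) 2 μ) (hu₂ : ∀ j, MemLp (C.u₂ j) 2 μ) :
    √(∫ ω, C.passive m i ω ^ 2 ∂μ) - √(∫ ω, drive C.a C.u₁ m i ω ^ 2 ∂μ)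
      - √(∫ ω, drive C.a C.u₂ m i ω ^ 2 ∂μ) ≤ √(∫ ω, C.pre (m + i) ω ^ 2 ∂μ) := by
  have l₁ := memLp_drive C.a (m := m) hu₁ i
  have l₂ := memLp_drive C.a (m := m) hu₂ i
  have k₁ := sqrt_integral_add_sq_le (hx (m + i)) ((l₁.add l₂).neg)
  have k₂ := sqrt_integral_add_sq_le l₁ l₂
  have e : ∀ ω, C.pre (m + i) ω + (-(drive C.a C.u₁ m i + drive C.a C.u₂ m i)) ω
      = C.passive m i ω := fun ω => by
    rw [pre_add_eq, Pi.neg_apply, Pi.add_apply, add_neg_cancel_right]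
  simp_rw [e] at k₁
  have e' : ∀ ω, (-(drive C.a C.u₁ m i + drive C.a C.u₂ m i)) ω ^ 2
      = (drive C.a C.u₁ m i ω + drive C.a C.u₂ m i ω) ^ 2 := fun ω => by
    rw [Pi.neg_apply, Pi.add_apply, neg_sq]
  simp_rw [e'] at k₁
  linarith

end Propagation

/-! ### Closed forms of the bounds -/

section ClosedForms

variable {a : ℝ}

lemma le_sq_of_le_abs (ha : 2.5 ≤ |a|) : 6.25 ≤ a ^ 2 := by
  rw [← sq_abs]
  nlinarith

lemma ne_zero_of_le_abs (ha : 2.5 ≤ |a|) : a ≠ 0 := by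
  rintro rfl
  norm_num at ha

lemma ratio_lt_one (ha : 2.5 ≤ |a|) : 2.5 * a ^ (-2 : ℤ) < 1 := by
  have h := le_sq_of_le_abs ha
  have e : a ^ (-2 : ℤ) = (a ^ 2)⁻¹ := by rw [zpow_neg]; norm_cast
  rw [e, ← div_eq_mul_inv, div_lt_one (by linarith)]
  linarith

lemma gainSum_eq (ha : 2.5 ≤ |a|) (L : ℕ) :
    gainSum a L = a ^ (2 * ((L : ℤ) - 1)) * (1 - (2.5 * a ^ (-2 : ℤ)) ^ (L : ℤ)) /
      (1 - 2.5 * a ^ (-2 : ℤ)) := by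
  have ha0 := ne_zero_of_le_abs ha
  have hr := ratio_lt_one ha
  have hr0 : 1 - 2.5 * a ^ (-2 : ℤ) ≠ 0 := by linarith
  induction L with
  | zero => simp [gainSum]
  | succ L ih =>
    rw [gainSum_succ, ih]
    have e₁ : a ^ (2 * (((L + 1 : ℕ) : ℤ) - 1)) = a ^ 2 * a ^ (2 * ((L : ℤ) - 1)) := by
      rw [← zpow_natCast a 2, ← zpow_add₀ ha0]
      congr 1
      push_cast
      ring
    have e₂ : (2.5 : ℝ) ^ L = a ^ 2 * a ^ (2 * ((L : ℤ) - 1)) * (2.5 * a ^ (-2 : ℤ)) ^ L := by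
      rw [mul_pow, ← zpow_natCast a 2, ← zpow_natCast (a ^ (-2 : ℤ)) L, ← zpow_mul,
        ← zpow_add₀ ha0, mul_left_comm, ← zpow_add₀ ha0]
      have : ((2 : ℕ) : ℤ) + 2 * ((L : ℤ) - 1) + -2 * (L : ℤ) = 0 := by push_cast; ring
      rw [this]
      simp
    rw [e₁, zpow_natCast, zpow_natCast, pow_succ, e₂]
    generalize 2.5 * a ^ (-2 : ℤ) = r at hr0
    field_simp
    ring

lemma powerTerm_eq (ha : 2.5 ≤ |a|) (k₁ L : ℕ) (P : ℝ) :
    powerTerm a k₁ (k₁ + 1 + L) P = gainSum a L * (P / ((1 - 2.5⁻¹) * 2.5⁻¹)) := by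
  rw [powerTerm, gainSum_eq ha]
  have e₁ : ((k₁ + 1 + L : ℕ) : ℤ) - k₁ - 2 = (L : ℤ) - 1 := by push_cast; ring
  have e₂ : ((k₁ + 1 + L : ℕ) : ℤ) - k₁ - 1 = (L : ℤ) := by push_cast; ring
  rw [e₁, e₂]

lemma gainSum_le (ha : 2.5 ≤ |a|) (L : ℕ) :
    gainSum a L ≤ a ^ (2 * ((L : ℤ) - 1)) / (1 - 2.5 * a ^ (-2 : ℤ)) := by
  have hr := ratio_lt_one ha
  rw [gainSum_eq ha]
  have h₁ : 0 ≤ a ^ (2 * ((L : ℤ) - 1)) := (even_two_mul _).zpow_nonneg a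
  have h₂ : 0 ≤ (2.5 * a ^ (-2 : ℤ)) ^ (L : ℤ) := by
    have : 0 ≤ a ^ (-2 : ℤ) := (by decide : Even (-2 : ℤ)).zpow_nonneg a
    positivity
  refine div_le_div_of_nonneg_right ?_ (by linarith)
  nlinarith

lemma gainSum_succ_pos (a : ℝ) (L : ℕ) : 0 < gainSum a (L + 1) := by
  rw [gainSum_succ]
  have := gainSum_nonneg a L
  positivity

lemma geometric_eq (ha : 2.5 ≤ |a|) (k : ℕ) :
    a ^ (2 * (((k + 1 : ℕ) : ℤ) - 2)) * (1 - a ^ (-2 * (((k + 1 : ℕ) : ℤ) - 1))) /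
      (1 - a ^ (-2 : ℤ)) = ∑ j ∈ Finset.range k, a ^ (2 * j) := by
  have ha0 := ne_zero_of_le_abs ha
  have h := le_sq_of_le_abs ha
  have e : a ^ (-2 : ℤ) = (a ^ 2)⁻¹ := by rw [zpow_neg]; norm_cast
  have hs : ∑ j ∈ Finset.range k, a ^ (2 * j) = ((a ^ 2) ^ k - 1) / (a ^ 2 - 1) := by
    simp_rw [pow_mul]
    exact geom_sum_eq (by linarith) k
  have e₁ : a ^ (2 * (((k + 1 : ℕ) : ℤ) - 2)) = (a ^ 2) ^ k * (a ^ 2)⁻¹ := by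
    rw [← e, ← pow_mul, ← zpow_natCast a (2 * k), ← zpow_add₀ ha0]
    congr 1
    push_cast
    ring
  have e₂ : a ^ (-2 * (((k + 1 : ℕ) : ℤ) - 1)) = ((a ^ 2) ^ k)⁻¹ := by
    rw [← pow_mul, ← zpow_natCast a (2 * k), ← zpow_neg]
    congr 1
    push_cast
    ring
  rw [hs, e₁, e₂, e]
  have h₁ : a ^ 2 - 1 ≠ 0 := by linarith
  have h₂ : 1 - (a ^ 2)⁻¹ ≠ 0 := by
    have : (a ^ 2)⁻¹ < 1 := inv_lt_one_of_one_lt₀ (by linarith)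
    linarith
  have h₃ : (1 - (a ^ 2)⁻¹) = (a ^ 2 - 1) * (a ^ 2)⁻¹ := by field_simp
  rw [h₃]
  field_simp

lemma infoVar_succ (ha : 2.5 ≤ |a|) (σ₁ σ₂ : ℝ) (k : ℕ) :
    infoVar a σ₁ σ₂ (k + 1) = a ^ (2 * k) * σ₁ ^ 2 /
      ((1 + σ₁ ^ 2 / σ₂ ^ 2) * ∑ j ∈ Finset.range k, a ^ (2 * j) + σ₁ ^ 2) := by
  rw [infoVar, geometric_eq ha]
  congr 2
  rw [← zpow_natCast a (2 * k)]
  congr 1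
  push_cast
  ring

/-- The variance of the innovation at the `k`-th step after a disturbance: the upper limit of the
parameter `Σ`. It differs from `infoVar` only at `k = 1` for `σ₁ = 0`. -/
def innovationVar (a σ₁ σ₂ : ℝ) (k : ℕ) : ℝ := if k = 1 then 1 else infoVar a σ₁ σ₂ k

lemma infoVar_le_innovationVar (ha : 2.5 ≤ |a|) (σ₁ σ₂ : ℝ) {k : ℕ} :
    infoVar a σ₁ σ₂ k ≤ innovationVar a σ₁ σ₂ k := by
  unfold innovationVar
  split_ifs with h
  · subst h
    rw [infoVar_succ ha (k := 0)]
    simpa using div_self_le_one (σ₁ ^ 2)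
  · exact le_rfl

lemma innovationVar_eq (ha : 2.5 ≤ |a|) {σ₁ σ₂ : ℝ} (h₁ : 0 < σ₁) (k : ℕ) :
    innovationVar a σ₁ σ₂ (k + 1) = a ^ (2 * k) * σ₁ ^ 2 /
      ((1 + σ₁ ^ 2 / σ₂ ^ 2) * ∑ j ∈ Finset.range k, a ^ (2 * j) + σ₁ ^ 2) := by
  rcases Nat.eq_zero_or_pos k with rfl | hk
  · have : σ₁ ^ 2 ≠ 0 := by positivity
    simp [innovationVar, div_self this]
  · rw [innovationVar, if_neg (by omega), infoVar_succ ha]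

/-- The gains of the Kalman filter, and the recursion of the error variances. -/
lemma exists_kalman_gains (ha : 2.5 ≤ |a|) {σ₁ σ₂ : ℝ} (h₁ : 0 ≤ σ₁) (h₁₂ : σ₁ ≤ σ₂) (k : ℕ) :
    ∃ c₁ c₂ : ℝ,
      (1 - c₁ - c₂) * innovationVar a σ₁ σ₂ (k + 1) = c₁ * σ₁ ^ 2 ∧
      (1 - c₁ - c₂) * innovationVar a σ₁ σ₂ (k + 1) = c₂ * σ₂ ^ 2 ∧
      innovationVar a σ₁ σ₂ (k + 2) = a ^ 2 * ((1 - c₁ - c₂) ^ 2 *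
        innovationVar a σ₁ σ₂ (k + 1) + c₁ ^ 2 * σ₁ ^ 2 + c₂ ^ 2 * σ₂ ^ 2) := by
  rcases h₁.eq_or_lt with h0 | hpos
  · -- A noiseless observation determines the innovation.
    subst h0
    refine ⟨1, 0, by ring, by ring, ?_⟩
    rw [innovationVar, if_neg (by omega), infoVar_succ ha (k := k + 1)]
    simp
  · have hpos₂ : 0 < σ₂ := hpos.trans_le h₁₂
    set V := innovationVar a σ₁ σ₂ (k + 1) with hV
    have hVe := innovationVar_eq ha (σ₂ := σ₂) hpos k
    have hVe' := innovationVar_eq ha (σ₂ := σ₂) hpos (k + 1)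
    rw [Finset.sum_range_succ] at hVe'
    set g := ∑ j ∈ Finset.range k, a ^ (2 * j) with hg
    have hg0 : 0 ≤ g := Finset.sum_nonneg fun j _ => by rw [pow_mul]; positivity
    have hA : 0 ≤ a ^ (2 * k) := by rw [pow_mul]; positivity
    set A := a ^ (2 * k) with hAdef
    have hD : 0 < (1 + σ₁ ^ 2 / σ₂ ^ 2) * g + σ₁ ^ 2 := by positivity
    have hV0 : 0 ≤ V := by rw [hV, hVe]; positivity
    have hq : 0 < 1 + V / σ₁ ^ 2 + V / σ₂ ^ 2 := by positivity
    have hsum : 1 - V / σ₁ ^ 2 / (1 + V / σ₁ ^ 2 + V / σ₂ ^ 2)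
        - V / σ₂ ^ 2 / (1 + V / σ₁ ^ 2 + V / σ₂ ^ 2) = 1 / (1 + V / σ₁ ^ 2 + V / σ₂ ^ 2) := by
      rw [eq_div_iff hq.ne', sub_mul, sub_mul, div_mul_cancel₀ _ hq.ne', div_mul_cancel₀ _ hq.ne']
      ring
    refine ⟨V / σ₁ ^ 2 / (1 + V / σ₁ ^ 2 + V / σ₂ ^ 2),
      V / σ₂ ^ 2 / (1 + V / σ₁ ^ 2 + V / σ₂ ^ 2), ?_, ?_, ?_⟩
    · rw [hsum]
      field_simp
    · rw [hsum]
      field_simp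
    · rw [hsum, hVe']
      have e : (1 / (1 + V / σ₁ ^ 2 + V / σ₂ ^ 2)) ^ 2 * V
          + (V / σ₁ ^ 2 / (1 + V / σ₁ ^ 2 + V / σ₂ ^ 2)) ^ 2 * σ₁ ^ 2
          + (V / σ₂ ^ 2 / (1 + V / σ₁ ^ 2 + V / σ₂ ^ 2)) ^ 2 * σ₂ ^ 2
          = V / (1 + V / σ₁ ^ 2 + V / σ₂ ^ 2) := by
        have hx : V / σ₁ ^ 2 * σ₁ ^ 2 = V := div_mul_cancel₀ _ (by positivity)
        have hy : V / σ₂ ^ 2 * σ₂ ^ 2 = V := div_mul_cancel₀ _ (by positivity)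
        generalize V / σ₁ ^ 2 = x at *
        generalize V / σ₂ ^ 2 = y at *
        have hnum : V + x ^ 2 * σ₁ ^ 2 + y ^ 2 * σ₂ ^ 2 = V * (1 + x + y) := by
          linear_combination x * hx + y * hy
        calc (1 / (1 + x + y)) ^ 2 * V + (x / (1 + x + y)) ^ 2 * σ₁ ^ 2
              + (y / (1 + x + y)) ^ 2 * σ₂ ^ 2
            = (V + x ^ 2 * σ₁ ^ 2 + y ^ 2 * σ₂ ^ 2) / (1 + x + y) ^ 2 := by
              generalize 1 + x + y = Q
              ring
          _ = V / (1 + x + y) := by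
            rw [hnum, pow_two, mul_div_mul_right _ _ hq.ne']
      rw [e]
      have hVD : V * ((1 + σ₁ ^ 2 / σ₂ ^ 2) * g + σ₁ ^ 2) = A * σ₁ ^ 2 := by
        rw [hV, hVe, div_mul_cancel₀ _ hD.ne']
      have hpow : a ^ (2 * (k + 1)) = a ^ 2 * A := by rw [hAdef]; ring
      have hD' : 0 < (1 + σ₁ ^ 2 / σ₂ ^ 2) * (g + A) + σ₁ ^ 2 := by positivity
      rw [hpow, ← mul_div_assoc, div_eq_div_iff hD'.ne' hq.ne']
      have z₁ : σ₁ ^ 2 * (V / σ₁ ^ 2) = V := by field_simp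
      have z₂ : σ₁ ^ 2 * (V / σ₂ ^ 2) = V * (σ₁ ^ 2 / σ₂ ^ 2) := by ring
      linear_combination (a ^ 2 * A) * z₁ + (a ^ 2 * A) * z₂ - a ^ 2 * hVD

end ClosedForms

section InnovationExists

variable {Ω : Type*} {mΩ : MeasurableSpace Ω} {μ : Measure Ω} [IsProbabilityMeasure μ]
  {σ₀ σ₁ σ₂ : ℝ≥0} {C : ClosedLoop Ω}

/-- The Kalman filter started at the disturbance `w[n]`. -/
lemma exists_isInnovation (hN : IsNoise μ σ₀ σ₁ σ₂ C.ξ) (hσ : σ₁ ≤ σ₂) (ha : 2.5 ≤ |C.a|)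
    (n k : ℕ) : ∃ X F, IsInnovation C μ (n + (k + 1)) (innovationVar C.a σ₁ σ₂ (k + 1)) X F := by
  induction k with
  | zero => exact ⟨_, _, by simpa [innovationVar] using isInnovation_w hN n⟩
  | succ k ih =>
    obtain ⟨X, F, h⟩ := ih
    obtain ⟨c₁, c₂, h₁, h₂, h₃⟩ := exists_kalman_gains ha σ₁.2 (NNReal.coe_le_coe.2 hσ) k
    rw [show innovationVar C.a σ₁ σ₂ (k + 1 + 1) = _ from h₃]
    exact h.succ hN h₁ h₂

end InnovationExists

/-! ### From the average cost to a single window -/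

section Cost

variable {Ω : Type*} {mΩ : MeasurableSpace Ω} {μ : Measure Ω} {σ₀ σ₁ σ₂ : ℝ≥0}

/-- The weighted power of the inputs `u` in the window `s, …, s + L - 1`. -/
def inputPower (μ : Measure Ω) (u : ℕ → Ω → ℝ) (s L : ℕ) : ℝ :=
  ∑ j ∈ Finset.range L, weight j * ∫ ω, u (s + j) ω ^ 2 ∂μ

lemma inputPower_nonneg (u : ℕ → Ω → ℝ) (s L : ℕ) : 0 ≤ inputPower μ u s L :=
  Finset.sum_nonneg fun j _ => mul_nonneg (weight_pos j).le (integral_nonneg fun _ => sq_nonneg _)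

lemma windowPower_eq_ofReal {u : ℕ → Ω → ℝ} (hu : ∀ j, MemLp (u j) 2 μ) (s L : ℕ) :
    windowPower (fun m => secondMoment μ (u m)) s L = ENNReal.ofReal (inputPower μ u s L) := by
  unfold windowPower inputPower
  rw [ENNReal.ofReal_sum_of_nonneg fun j _ =>
    mul_nonneg (weight_pos j).le (integral_nonneg fun _ => sq_nonneg _)]
  refine Finset.sum_congr rfl fun j _ => ?_
  beta_reduce
  rw [secondMoment_eq_ofReal (hu _), ENNReal.ofReal_mul (weight_pos j).le]

lemma weightedInf_le (q r₁ r₂ : ℝ≥0) (D : ℝ → ℝ → ℝ) {P₁ P₂ d : ℝ} (h₁ : 0 ≤ P₁) (h₂ : 0 ≤ P₂)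
    (hd : D P₁ P₂ ≤ d) :
    weightedInf q r₁ r₂ D ≤ q * ENNReal.ofReal d + r₁ * ENNReal.ofReal P₁
      + r₂ * ENNReal.ofReal P₂ := by
  lift P₁ to ℝ≥0 using h₁
  lift P₂ to ℝ≥0 using h₂
  refine (iInf₂_le P₁ P₂).trans ?_
  refine (ENNReal.ofReal_le_ofReal (add_le_add_left (add_le_add_left
    (mul_le_mul_of_nonneg_left hd q.coe_nonneg) _) _)).trans ?_
  refine ENNReal.ofReal_add_le.trans (add_le_add (ENNReal.ofReal_add_le.trans
    (add_le_add ?_ ?_)) ?_)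
  · rw [ENNReal.ofReal_mul q.coe_nonneg, ENNReal.ofReal_coe_nnreal]
  · rw [ENNReal.ofReal_mul r₁.coe_nonneg, ENNReal.ofReal_coe_nnreal]
  · rw [ENNReal.ofReal_mul r₂.coe_nonneg, ENNReal.ofReal_coe_nnreal]

lemma weightedInf_ne_top (q r₁ r₂ : ℝ≥0) (D : ℝ → ℝ → ℝ) : weightedInf q r₁ r₂ D ≠ ∞ :=
  ne_top_of_le_ne_top ENNReal.ofReal_ne_top (iInf₂_le (0 : ℝ≥0) (0 : ℝ≥0))

/-- For `q = 0` the infimum is attained at zero powers. -/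
lemma weightedInf_zero (r₁ r₂ : ℝ≥0) (D : ℝ → ℝ → ℝ) : weightedInf 0 r₁ r₂ D = 0 := by
  have := weightedInf_le 0 r₁ r₂ D le_rfl le_rfl (le_refl (D 0 0))
  simpa using this

/-- A single infinite term makes all later averages infinite. -/
lemma ne_top_of_limsup_average_ne_top {c : ℕ → ℝ≥0∞}
    (h : limsup (fun N : ℕ => (∑ m ∈ Finset.range N, c m) / (N : ℝ≥0∞)) atTop ≠ ∞) (m : ℕ) :
    c m ≠ ∞ := by
  intro hm
  apply h
  have : (fun N : ℕ => (∑ m ∈ Finset.range N, c m) / (N : ℝ≥0∞)) =ᶠ[atTop] fun _ => ∞ := by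
    filter_upwards [eventually_gt_atTop m] with N hN
    rw [ENNReal.sum_eq_top.2 ⟨m, Finset.mem_range.2 hN, hm⟩, ENNReal.top_div_of_ne_top (by simp)]
  rw [limsup_congr this, limsup_const]

/-- Reduction of a bound on the average cost to a bound for a single window. The input powers
enter only if they are penalized; otherwise they may be infinite, and the infimum over the powers
can be taken at any point. -/
lemma weightedInf_le_averageCost [IsProbabilityMeasure μ] {C : ClosedLoop Ω}
    (hN : IsNoise μ σ₀ σ₁ σ₂ C.ξ) (q r₁ r₂ : ℝ≥0) (D : ℝ → ℝ → ℝ) {s L k : ℕ} (hk : s + L ≤ k)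
    (hfin : (∀ m, MemLp (C.x m) 2 μ) → (∀ m, MemLp (C.u₁ m) 2 μ) → (∀ m, MemLp (C.u₂ m) 2 μ) →
      ∀ n, D (inputPower μ C.u₁ (n + s) L) (inputPower μ C.u₂ (n + s) L)
        ≤ ∫ ω, C.x (n + k) ω ^ 2 ∂μ)
    (hfree : (∀ m, MemLp (C.x m) 2 μ) → ∀ n, ∃ P₁ P₂ : ℝ, 0 ≤ P₁ ∧ 0 ≤ P₂ ∧
      D P₁ P₂ ≤ ∫ ω, C.x (n + k) ω ^ 2 ∂μ) :
    weightedInf q r₁ r₂ D ≤ averageCost μ C.ξ C.a q r₁ r₂ C.f₁ C.f₂ := by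
  rcases eq_or_ne q 0 with rfl | hq
  · rw [weightedInf_zero]
    exact zero_le
  set c : ℕ → ℝ≥0∞ := fun m => (q : ℝ≥0∞) * secondMoment μ (C.x m)
    + (r₁ : ℝ≥0∞) * secondMoment μ (C.u₁ m) + (r₂ : ℝ≥0∞) * secondMoment μ (C.u₂ m) with hc
  have hcost : averageCost μ C.ξ C.a q r₁ r₂ C.f₁ C.f₂
      = limsup (fun N : ℕ => (∑ m ∈ Finset.range N, c m) / (N : ℝ≥0∞)) atTop := rfl
  rw [hcost]
  by_cases htop : limsup (fun N : ℕ => (∑ m ∈ Finset.range N, c m) / (N : ℝ≥0∞)) atTop = ∞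
  · rw [htop]
    exact le_top
  have hct := ne_top_of_limsup_average_ne_top htop
  have hmul {r : ℝ≥0} (hr : r ≠ 0) {z : ℝ≥0∞} (h : (r : ℝ≥0∞) * z ≠ ∞) : z ≠ ∞ := by
    rintro rfl
    exact h (ENNReal.mul_top (by simpa using hr))
  have hx : ∀ m, MemLp (C.x m) 2 μ := fun m =>
    memLp_of_secondMoment_ne_top ((C.measurable_x m).mono (hN.sourceAlg_le _) le_rfl)
      (hmul hq (ENNReal.add_ne_top.1 (ENNReal.add_ne_top.1 (hct m)).1).1)
  have hsum : ∀ m, MemLp (fun ω => C.u₁ m ω + C.u₂ m ω) 2 μ := by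
    intro m
    have e : (fun ω => C.u₁ m ω + C.u₂ m ω)
        = fun ω => C.x (m + 1) ω - C.a * C.x m ω - C.ξ (.w m) ω := by
      funext ω
      rw [C.x_succ, ClosedLoop.pre]
      ring
    rw [e]
    exact ((hx (m + 1)).sub ((hx m).const_mul C.a)).sub (hN.hasGaussianLaw _).memLp_two
  -- With finite cost the powers are finite, unless both inputs are free.
  have hwin : ∀ n, weightedInf q r₁ r₂ D ≤ q * secondMoment μ (C.x (n + k))
      + r₁ * windowPower (fun m => secondMoment μ (C.u₁ m)) (n + s) L
      + r₂ * windowPower (fun m => secondMoment μ (C.u₂ m)) (n + s) L := by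
    intro n
    rw [secondMoment_eq_ofReal (hx _)]
    by_cases hr : r₁ = 0 ∧ r₂ = 0
    · obtain ⟨P₁, P₂, h₁, h₂, hD⟩ := hfree hx n
      obtain ⟨rfl, rfl⟩ := hr
      simpa using weightedInf_le q 0 0 D h₁ h₂ hD
    · have hu : (∀ m, MemLp (C.u₁ m) 2 μ) ∧ ∀ m, MemLp (C.u₂ m) 2 μ := by
        have m₁ (m) := (C.measurable_u₁_present m).mono (hN.sourceAlg_le _) le_rfl
        have m₂ (m) := (C.measurable_u₂_present m).mono (hN.sourceAlg_le _) le_rfl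
        -- The sum of the inputs is square integrable, so it suffices that one of them is.
        rcases not_and_or.1 hr with hr | hr
        · have h₁ : ∀ m, MemLp (C.u₁ m) 2 μ := fun m => memLp_of_secondMoment_ne_top (m₁ m)
            (hmul hr (ENNReal.add_ne_top.1 (ENNReal.add_ne_top.1 (hct m)).1).2)
          refine ⟨h₁, fun m => ?_⟩
          have e : C.u₂ m = (fun ω => C.u₁ m ω + C.u₂ m ω) - C.u₁ m := by
            funext ω
            simp
          rw [e]
          exact (hsum m).sub (h₁ m)
        · have h₂ : ∀ m, MemLp (C.u₂ m) 2 μ := fun m => memLp_of_secondMoment_ne_top (m₂ m)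
            (hmul hr (ENNReal.add_ne_top.1 (hct m)).2)
          refine ⟨fun m => ?_, h₂⟩
          have e : C.u₁ m = (fun ω => C.u₁ m ω + C.u₂ m ω) - C.u₂ m := by
            funext ω
            simp
          rw [e]
          exact (hsum m).sub (h₂ m)
      rw [windowPower_eq_ofReal hu.1, windowPower_eq_ofReal hu.2]
      exact weightedInf_le q r₁ r₂ D (inputPower_nonneg _ _ _) (inputPower_nonneg _ _ _)
        (hfin hx hu.1 hu.2 n)
  refine le_limsup_average (weightedInf_ne_top q r₁ r₂ D) c k fun N => ?_
  calc (N : ℝ≥0∞) * weightedInf q r₁ r₂ D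
      = ∑ n ∈ Finset.range N, weightedInf q r₁ r₂ D := by simp
    _ ≤ ∑ n ∈ Finset.range N, (q * secondMoment μ (C.x (n + k))
          + r₁ * windowPower (fun m => secondMoment μ (C.u₁ m)) (n + s) L
          + r₂ * windowPower (fun m => secondMoment μ (C.u₂ m)) (n + s) L) :=
        Finset.sum_le_sum fun n _ => hwin n
    _ = q * ∑ n ∈ Finset.range N, secondMoment μ (C.x (n + k))
          + r₁ * ∑ n ∈ Finset.range N, windowPower (fun m => secondMoment μ (C.u₁ m)) (n + s) L
          + r₂ * ∑ n ∈ Finset.range N,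
            windowPower (fun m => secondMoment μ (C.u₂ m)) (n + s) L := by
        rw [Finset.sum_add_distrib, Finset.sum_add_distrib, Finset.mul_sum, Finset.mul_sum,
          Finset.mul_sum]
    _ ≤ q * ∑ m ∈ Finset.range (N + k), secondMoment μ (C.x m)
          + r₁ * ∑ m ∈ Finset.range (N + k), secondMoment μ (C.u₁ m)
          + r₂ * ∑ m ∈ Finset.range (N + k), secondMoment μ (C.u₂ m) := by
        gcongr
        · exact sum_shift_le (fun m => secondMoment μ (C.x m)) le_rfl
        · exact sum_windowPower_le _ hk N
        · exact sum_windowPower_le _ hk N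
    _ = ∑ m ∈ Finset.range (N + k), c m := by
        rw [hc, Finset.sum_add_distrib, Finset.sum_add_distrib, Finset.mul_sum, Finset.mul_sum,
          Finset.mul_sum]

end Cost

/-! ### The bounds for a single window -/

section Bounds

variable {Ω : Type*} {mΩ : MeasurableSpace Ω} {μ : Measure Ω} {σ₀ σ₁ σ₂ : ℝ≥0} {C : ClosedLoop Ω}

lemma memLp_pre (hN : IsNoise μ σ₀ σ₁ σ₂ C.ξ) (hx : ∀ m, MemLp (C.x m) 2 μ) (m : ℕ) :
    MemLp (C.pre m) 2 μ := by
  have e : C.pre m = C.x (m + 1) - C.ξ (.w m) := by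
    funext ω
    simp [C.x_succ]
  rw [e]
  exact (hx _).sub (hN.hasGaussianLaw _).memLp_two

lemma one_le_integral_x_sq (hN : IsNoise μ σ₀ σ₁ σ₂ C.ξ) (hx : ∀ m, MemLp (C.x m) 2 μ) (m : ℕ) :
    1 ≤ ∫ ω, C.x (m + 1) ω ^ 2 ∂μ := by
  rw [integral_x_succ_sq hN m (memLp_pre hN hx m)]
  exact le_add_of_nonneg_left (integral_nonneg fun ω => sq_nonneg _)

lemma integral_drive_sq_le_inputPower {u : ℕ → Ω → ℝ} (a : ℝ) (m : ℕ)
    (hu : ∀ j, MemLp (u j) 2 μ) (L : ℕ) :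
    ∫ ω, drive a u m L ω ^ 2 ∂μ
      ≤ gainSum a L * (inputPower μ u (m + 1) L / (1 - 2.5⁻¹)) := by
  refine (integral_drive_sq_le a m hu L).trans (le_of_eq ?_)
  congr 1
  unfold inputPower weight
  rw [Finset.sum_div]
  refine Finset.sum_congr rfl fun j _ => ?_
  rw [mul_assoc, mul_div_cancel_left₀ _ (by norm_num)]

/-- Splitting off the first input of a window; the rest is discounted by `2.5⁻¹`. -/
lemma inputPower_succ (u : ℕ → Ω → ℝ) (m L : ℕ) :
    inputPower μ u m (L + 1)
      = (1 - 2.5⁻¹) * ∫ ω, u m ω ^ 2 ∂μ + 2.5⁻¹ * inputPower μ u (m + 1) L := by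
  unfold inputPower
  rw [Finset.sum_range_succ', add_comm, Finset.mul_sum]
  congr 1
  · simp [weight]
  · refine Finset.sum_congr rfl fun j _ => ?_
    rw [weight, weight, pow_succ, show m + (j + 1) = m + 1 + j by ring]
    ring

lemma max_zero_sq_le {z s : ℝ} (hs : 0 ≤ s) (h : z ≤ √s) : max 0 z ^ 2 ≤ s :=
  (pow_le_pow_left₀ (le_max_left _ _) (max_le (Real.sqrt_nonneg _) h) 2).trans_eq
    (Real.sq_sqrt hs)

/-- A large enough input power makes `DL4` vanish. -/
lemma exists_DL4_eq_zero {a : ℝ} (ha : 2.5 ≤ |a|) (k : ℕ) : ∃ P : ℝ, 0 ≤ P ∧ DL4 a P 0 k = 0 := by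
  have ha0 := ne_zero_of_le_abs ha
  have hr : 0 < 1 - 2.5 * a ^ (-2 : ℤ) := by linarith [ratio_lt_one ha]
  have h₁ : 0 < a ^ (2 * ((k : ℤ) - 1)) := (even_two_mul _).zpow_pos ha0
  have h₂ : 0 < a ^ (2 * ((k : ℤ) - 2)) := (even_two_mul _).zpow_pos ha0
  refine ⟨a ^ (2 * ((k : ℤ) - 1)) / (a ^ (2 * ((k : ℤ) - 2)) / (1 - 2.5 * a ^ (-2 : ℤ)))
    * (1 - 2.5⁻¹), mul_nonneg (div_nonneg h₁.le (div_nonneg h₂.le hr.le)) (by norm_num), ?_⟩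
  have e : a ^ (2 * ((k : ℤ) - 2)) / (1 - 2.5 * a ^ (-2 : ℤ))
      * (a ^ (2 * ((k : ℤ) - 1)) / (a ^ (2 * ((k : ℤ) - 2)) / (1 - 2.5 * a ^ (-2 : ℤ)))
        * (1 - 2.5⁻¹) / (1 - 2.5⁻¹)) = a ^ (2 * ((k : ℤ) - 1)) := by
    rw [mul_div_cancel_right₀ _ (by norm_num), mul_div_cancel₀ _ (by positivity)]
  rw [DL4, e]
  simp

/-- The bound `DL2` is at most its value at any admissible pair of gains, and it may be evaluated
with a larger variance than `S`. -/
lemma DL2_le {a σ₁ σ₂ S V P₁ P₂ : ℝ} {k₁ k : ℕ} (hSV : S ≤ V) (c₁ c₂ : ℝ)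
    (h₁ : (1 - 2.5⁻¹) * (c₁ ^ 2 * (V + σ₁ ^ 2)) ≤ P₁)
    (h₂ : (1 - 2.5⁻¹) * (c₂ ^ 2 * (V + σ₂ ^ 2)) ≤ P₂) {t : ℝ} (ht : 0 ≤ t)
    (h : √(a ^ (2 * ((k : ℤ) - k₁ - 1)) *
        ((a - c₁ - c₂) ^ 2 * V + c₁ ^ 2 * σ₁ ^ 2 + c₂ ^ 2 * σ₂ ^ 2))
      - √(powerTerm a k₁ k P₁) - √(powerTerm a k₁ k P₂) ≤ √t) :
    DL2 a σ₁ σ₂ P₁ P₂ k₁ k S ≤ t + 1 := by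
  have hmono (c σ : ℝ) : (1 - 2.5⁻¹) * c ^ 2 * (S + σ ^ 2)
      ≤ (1 - 2.5⁻¹) * (c ^ 2 * (V + σ ^ 2)) := by
    rw [mul_assoc]
    gcongr
  have hpow : 0 ≤ a ^ (2 * ((k : ℤ) - k₁ - 1)) := (even_two_mul _).zpow_nonneg a
  refine csInf_le_of_le ⟨1, ?_⟩
    ⟨c₁, c₂, (hmono c₁ σ₁).trans h₁, (hmono c₂ σ₂).trans h₂, rfl⟩ ?_
  · rintro d ⟨_, _, _, _, rfl⟩
    exact le_add_of_nonneg_left (sq_nonneg _)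
  · refine add_le_add_left (max_zero_sq_le ht (le_trans ?_ h)) 1
    gcongr

lemma DL4_le (hN : IsNoise μ σ₀ σ₁ σ₂ C.ξ) (ha : 2.5 ≤ |C.a|)
    (hx : ∀ m, MemLp (C.x m) 2 μ) (hu₁ : ∀ m, MemLp (C.u₁ m) 2 μ)
    (hu₂ : ∀ m, MemLp (C.u₂ m) 2 μ) (n i : ℕ) :
    DL4 C.a (inputPower μ C.u₁ (n + 1) (i + 1)) (inputPower μ C.u₂ (n + 1) (i + 1)) (i + 2)
      ≤ ∫ ω, C.x (n + (i + 2)) ω ^ 2 ∂μ := by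
  have hS := memLp_pre hN hx
  have hlast := integral_x_succ_sq hN (n + (i + 1)) (hS _)
  have hpass := Real.sqrt_le_sqrt (pow_le_integral_passive_succ_sq hN (hS n) i)
  have htri := sqrt_integral_passive_le n (i + 1) hS hu₁ hu₂
  have e : C.a ^ (2 * (((i + 2 : ℕ) : ℤ) - 1)) = C.a ^ (2 * (i + 1)) := by
    rw [← zpow_natCast]
    congr 1
    push_cast
    ring
  have hd {u : ℕ → Ω → ℝ} (hu : ∀ j, MemLp (u j) 2 μ) :
      √(∫ ω, drive C.a u n (i + 1) ω ^ 2 ∂μ)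
        ≤ √(C.a ^ (2 * (((i + 2 : ℕ) : ℤ) - 2)) / (1 - 2.5 * C.a ^ (-2 : ℤ))
          * (inputPower μ u (n + 1) (i + 1) / (1 - 2.5⁻¹))) := by
    refine Real.sqrt_le_sqrt ((integral_drive_sq_le_inputPower C.a n hu (i + 1)).trans
      (mul_le_mul_of_nonneg_right ((gainSum_le ha (i + 1)).trans_eq ?_)
        (div_nonneg (inputPower_nonneg _ _ _) (by norm_num))))
    congr 3
    push_cast
    ring
  refine (max_zero_sq_le (integral_nonneg fun ω => sq_nonneg _) ?_).trans
    ((le_add_of_nonneg_right zero_le_one).trans_eq hlast.symm)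
  rw [e]
  have d₁ := hd hu₁
  have d₂ := hd hu₂
  linarith

variable [IsProbabilityMeasure μ]

lemma DL3_le (hN : IsNoise μ σ₀ σ₁ σ₂ C.ξ) (hσ : σ₁ ≤ σ₂) (ha : 2.5 ≤ |C.a|)
    (hx : ∀ m, MemLp (C.x m) 2 μ) (n k : ℕ) (P₁ P₂ : ℝ) :
    DL3 C.a σ₁ σ₂ P₁ P₂ (k + 1) ≤ ∫ ω, C.x (n + (k + 1)) ω ^ 2 ∂μ := by
  obtain ⟨X, F, h⟩ := exists_isInnovation hN hσ ha n k
  exact max_le ((infoVar_le_innovationVar ha _ _).trans (h.le_integral_x_sq hN (hx _)))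
    (one_le_integral_x_sq hN hx (n + k))

lemma DL2_le_integral (hN : IsNoise μ σ₀ σ₁ σ₂ C.ξ) (hσ : σ₁ ≤ σ₂) (ha : 2.5 ≤ |C.a|)
    (hx : ∀ m, MemLp (C.x m) 2 μ) (hu₁ : ∀ m, MemLp (C.u₁ m) 2 μ)
    (hu₂ : ∀ m, MemLp (C.u₂ m) 2 μ) (n i L : ℕ) {S : ℝ}
    (hS : S ≤ innovationVar C.a σ₁ σ₂ (i + 1)) :
    DL2 C.a σ₁ σ₂ (inputPower μ C.u₁ (n + (i + 1)) (L + 1))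
        (inputPower μ C.u₂ (n + (i + 1)) (L + 1)) (i + 1) (i + 1 + 1 + L) S
      ≤ ∫ ω, C.x (n + (i + 1 + 1 + L)) ω ^ 2 ∂μ := by
  obtain ⟨X, F, h⟩ := exists_isInnovation hN hσ ha n i
  obtain ⟨c₁, c₂, hc₁, hc₂, hc⟩ := h.exists_linear_gains hN (hx _) (hu₁ _) (hu₂ _)
  set m := n + (i + 1) with hm
  have hp := memLp_pre hN hx
  have hpow (u : ℕ → Ω → ℝ) {z : ℝ} (hz : z ≤ ∫ ω, u m ω ^ 2 ∂μ) :
      (1 - 2.5⁻¹) * z ≤ inputPower μ u m (L + 1) := by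
    rw [inputPower_succ]
    have h₁ := inputPower_nonneg (μ := μ) u (m + 1) L
    have h₂ : (1 - 2.5⁻¹) * z ≤ (1 - 2.5⁻¹) * ∫ ω, u m ω ^ 2 ∂μ :=
      mul_le_mul_of_nonneg_left hz (by norm_num)
    have h₃ : 0 ≤ 2.5⁻¹ * inputPower μ u (m + 1) L := by positivity
    linarith
  have hd {u : ℕ → Ω → ℝ} (hu : ∀ j, MemLp (u j) 2 μ) : √(∫ ω, drive C.a u m L ω ^ 2 ∂μ)
      ≤ √(powerTerm C.a (i + 1) (i + 1 + 1 + L) (inputPower μ u m (L + 1))) := by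
    rw [powerTerm_eq ha]
    refine Real.sqrt_le_sqrt ((integral_drive_sq_le_inputPower C.a m hu L).trans
      (mul_le_mul_of_nonneg_left ?_ (gainSum_nonneg _ _)))
    have h₁ : 0 ≤ (1 - 2.5⁻¹) * ∫ ω, u m ω ^ 2 ∂μ :=
      mul_nonneg (by norm_num) (integral_nonneg fun ω => sq_nonneg _)
    have h₂ := inputPower_succ (μ := μ) u m L
    rw [mul_comm (1 - 2.5⁻¹ : ℝ), ← div_div]
    refine div_le_div_of_nonneg_right ?_ (by norm_num)
    rw [le_div_iff₀ (by norm_num)]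
    linarith
  rw [show n + (i + 1 + 1 + L) = m + L + 1 by omega, integral_x_succ_sq hN _ (hp _)]
  refine DL2_le hS c₁ c₂ (hpow C.u₁ hc₁) (hpow C.u₂ hc₂)
    (integral_nonneg fun ω => sq_nonneg _) ?_
  have e : C.a ^ (2 * (((i + 1 + 1 + L : ℕ) : ℤ) - ((i + 1 : ℕ) : ℤ) - 1)) = C.a ^ (2 * L) := by
    rw [← zpow_natCast]
    congr 1
    push_cast
    ring
  rw [e]
  have hpass : √(C.a ^ (2 * L) * ((C.a - c₁ - c₂) ^ 2 * innovationVar C.a σ₁ σ₂ (i + 1)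
      + c₁ ^ 2 * σ₁ ^ 2 + c₂ ^ 2 * σ₂ ^ 2)) ≤ √(∫ ω, C.passive m L ω ^ 2 ∂μ) :=
    Real.sqrt_le_sqrt ((mul_le_mul_of_nonneg_left hc (by rw [pow_mul]; positivity)).trans
      (pow_mul_le_integral_passive_sq hN (hp m) L))
  have htri := sqrt_integral_passive_le m L hp hu₁ hu₂
  have d₁ := hd hu₁
  have d₂ := hd hu₂
  linarith

/-- With free inputs, the bound `DL2` is a bound on centralized control: for `k = k₁ + 1` the
optimal gains are `a` times those of the Kalman filter, and for larger `k` a large power of the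
later inputs brings `DL2` down to `1`. -/
lemma exists_DL2_le_integral (hN : IsNoise μ σ₀ σ₁ σ₂ C.ξ) (hσ : σ₁ ≤ σ₂) (ha : 2.5 ≤ |C.a|)
    (hx : ∀ m, MemLp (C.x m) 2 μ) (n i L : ℕ) {S : ℝ}
    (hS : S ≤ innovationVar C.a σ₁ σ₂ (i + 1)) :
    ∃ P₁ P₂ : ℝ, 0 ≤ P₁ ∧ 0 ≤ P₂ ∧ DL2 C.a σ₁ σ₂ P₁ P₂ (i + 1) (i + 1 + 1 + L) S
      ≤ ∫ ω, C.x (n + (i + 1 + 1 + L)) ω ^ 2 ∂μ := by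
  obtain ⟨X, F, h⟩ := exists_isInnovation hN hσ ha n i
  set V := innovationVar C.a σ₁ σ₂ (i + 1) with hV
  have hV0 := h.var_nonneg
  have hp := memLp_pre hN hx
  cases L with
  | zero =>
    obtain ⟨c₁, c₂, h₁, h₂, -⟩ := exists_kalman_gains ha σ₁.2 (NNReal.coe_le_coe.2 hσ) i
    have hpre := h.le_integral_pre_sq hN (hp _) h₁ h₂
    refine ⟨(1 - 2.5⁻¹) * ((C.a * c₁) ^ 2 * (V + σ₁ ^ 2)),
      (1 - 2.5⁻¹) * ((C.a * c₂) ^ 2 * (V + σ₂ ^ 2)), mul_nonneg (by norm_num) (by positivity),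
      mul_nonneg (by norm_num) (by positivity), ?_⟩
    rw [show n + (i + 1 + 1 + 0) = n + (i + 1) + 1 by omega, integral_x_succ_sq hN _ (hp _)]
    refine DL2_le hS (C.a * c₁) (C.a * c₂) le_rfl le_rfl
      (integral_nonneg fun ω => sq_nonneg _) ?_
    rw [powerTerm_eq ha, powerTerm_eq ha]
    simp only [gainSum, Finset.range_zero, Finset.sum_empty, zero_mul, Real.sqrt_zero, sub_zero]
    refine Real.sqrt_le_sqrt (le_trans (le_of_eq ?_) hpre)
    have e : (2 * (((i + 1 + 1 + 0 : ℕ) : ℤ) - ((i + 1 : ℕ) : ℤ) - 1)) = 0 := by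
      push_cast
      ring
    rw [e, zpow_zero]
    ring
  | succ L =>
    have hg := gainSum_succ_pos C.a L
    set K := C.a ^ (2 * (((i + 1 + 1 + (L + 1) : ℕ) : ℤ) - ((i + 1 : ℕ) : ℤ) - 1))
      * ((C.a - 0 - 0) ^ 2 * V + 0 ^ 2 * (σ₁ : ℝ) ^ 2 + 0 ^ 2 * (σ₂ : ℝ) ^ 2) with hK
    have hK0 : 0 ≤ K := mul_nonneg ((even_two_mul _).zpow_nonneg _) (by positivity)
    -- The power is chosen so that the power term equals the whole term `K` under the first root.
    refine ⟨K / gainSum C.a (L + 1) * ((1 - 2.5⁻¹) * 2.5⁻¹), 0,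
      mul_nonneg (by positivity) (by norm_num), le_rfl, ?_⟩
    refine le_trans ?_ (one_le_integral_x_sq hN hx (n + (i + 1 + 1 + L)))
    refine (DL2_le (t := 0) hS 0 0 ?_ (by simp) le_rfl ?_).trans_eq (zero_add 1)
    · rw [zero_pow two_ne_zero, zero_mul, mul_zero]
      exact mul_nonneg (by positivity) (by norm_num)
    · rw [powerTerm_eq ha, powerTerm_eq ha, mul_div_cancel_right₀ _ (by norm_num),
        mul_div_cancel₀ _ hg.ne', ← hK]
      simp

end Bounds

end DecentralizedLQG

end

open DecentralizedLQG in
theorem lemma16 {Ω : Type*} [MeasurableSpace Ω] (μ : MeasureTheory.Measure Ω)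
    [MeasureTheory.IsProbabilityMeasure μ]
    (a : ℝ) (ha : 2.5 ≤ |a|) (σ₀ σ₁ σ₂ : NNReal) (hσ : σ₁ ≤ σ₂)
    (ξ : DecentralizedLQG.Source → Ω → ℝ) (hξ : DecentralizedLQG.IsNoise μ σ₀ σ₁ σ₂ ξ)
    (q r₁ r₂ : NNReal) :
    (⨆ p ∈ DecentralizedLQG.SL2 a σ₁ σ₂,
        DecentralizedLQG.weightedInf q r₁ r₂
          (fun P₁ P₂ => DecentralizedLQG.DL2 a σ₁ σ₂ P₁ P₂ p.1 p.2.1 p.2.2))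
      ≤ DecentralizedLQG.optimalCost μ ξ a q r₁ r₂ ∧
    (⨆ k₁ ∈ DecentralizedLQG.SL3,
        DecentralizedLQG.weightedInf q r₁ r₂
          (fun P₁ P₂ => DecentralizedLQG.DL3 a σ₁ σ₂ P₁ P₂ k₁))
      ≤ DecentralizedLQG.optimalCost μ ξ a q r₁ r₂ ∧
    (⨆ k ∈ DecentralizedLQG.SL4,
        DecentralizedLQG.weightedInf q r₁ r₂
          (fun P₁ P₂ => DecentralizedLQG.DL4 a P₁ P₂ k))
      ≤ DecentralizedLQG.optimalCost μ ξ a q r₁ r₂ := by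
  refine ⟨iSup₂_le ?_, iSup₂_le ?_, iSup₂_le ?_⟩
  · rintro ⟨k₁, k, S⟩ ⟨h₁, h₂, -, h₄⟩
    refine le_iInf₂ fun f₁ f₂ => ?_
    obtain ⟨i, rfl⟩ : ∃ i, k₁ = i + 1 := ⟨k₁ - 1, by simp only at h₁; omega⟩
    obtain ⟨L, rfl⟩ : ∃ L, k = i + 1 + 1 + L := ⟨k - (i + 2), by simp only at h₂; omega⟩
    exact weightedInf_le_averageCost (C := ⟨ξ, a, f₁, f₂⟩) hξ q r₁ r₂ _
      (s := i + 1) (L := L + 1) (k := i + 1 + 1 + L) (by omega)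
      (fun hx hu₁ hu₂ n => DL2_le_integral hξ hσ ha hx hu₁ hu₂ n i L h₄)
      (fun hx n => exists_DL2_le_integral hξ hσ ha hx n i L h₄)
  · intro k₁ h₁
    refine le_iInf₂ fun f₁ f₂ => ?_
    obtain ⟨i, rfl⟩ : ∃ i, k₁ = i + 1 := ⟨k₁ - 1, by have : 1 ≤ k₁ := h₁; omega⟩
    exact weightedInf_le_averageCost (C := ⟨ξ, a, f₁, f₂⟩) hξ q r₁ r₂ _
      (s := 0) (L := 0) (k := i + 1) (by omega)
      (fun hx _ _ n => DL3_le hξ hσ ha hx n i _ _)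
      (fun hx n => ⟨0, 0, le_rfl, le_rfl, DL3_le hξ hσ ha hx n i _ _⟩)
  · intro k hk
    refine le_iInf₂ fun f₁ f₂ => ?_
    obtain ⟨i, rfl⟩ : ∃ i, k = i + 2 := ⟨k - 2, by have : 2 ≤ k := hk; omega⟩
    refine weightedInf_le_averageCost (C := ⟨ξ, a, f₁, f₂⟩) hξ q r₁ r₂ _
      (s := 1) (L := i + 1) (k := i + 2) (by omega)
      (fun hx hu₁ hu₂ n => DL4_le hξ ha hx hu₁ hu₂ n i) (fun _ n => ?_)
    obtain ⟨P, hP, hD⟩ := exists_DL4_eq_zero ha (i + 2)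
    exact ⟨P, 0, hP, le_rfl, hD.trans_le (integral_nonneg fun ω => sq_nonneg _)⟩
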